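/- Broadcasting in a graph $G$ starts from one informed vertex, the originator; in each time unit every informed vertex may inform at most one uninformed neighbour. Let $b(v,G)$ be the least number of time units in which all vertices can be informed from originator $v$, and $b(G)=\max_v b(v,G)$. A graph on $n$ vertices is a broadcast graph if $b(G)=\lceil\log_2 n\rceil$. The Accelerated-Binomial graph $AB_k$, with terminals $s,t$, has $2^k+1$ vertices and is built as follows. Start with the edge $\{s,t\}$ and, in each step $i=1,\dots,k$, give every vertex $v\ne t$ present so far a new child $v'$, adjacent to $v$ and to $t$. The non-$t$ vertices thus form a binomial tree $BT_k$ rooted at $s$. Label $s$ with $0$ and each vertex born in step $i$ with $\lceil i/3\rceil$, and join each vertex born in step $i$ also to its closest ancestor in the tree whose label is at most $\lceil i/3\rceil-1$ (if they are not already adjacent). The parallel composition of two graphs with terminals $s_1,t_1$ and $s_2,t_2$ is obtained by merging $s_1$ with $s_2$ and $t_1$ with $t_2$ (double edges are replaced by single ones). **Theorem.** Let $k\ge 2$ and let $P_k$ be the parallel composition of $G_1=AB_{k-1}$ and $G_2=AB_{\lfloor 3k/4\rfloor-1}$. 1. $P_k$ has $2^{k-1}+2^{\lfloor 3k/4\rfloor-1}$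 vertices, is planar, has broadcast time $k$, and is a broadcast graph. 2. For every $n$ with $2^{k-1}+1\le n\le 2^{k-1}+2^{\lfloor 3k/4\rfloor-1}$ we have $\lceil\log_2 n\rceil=k$, and there is a planar broadcast graph on $n$ vertices with broadcast time $k$; it can be chosen as an induced subgraph of $P_k$ obtained by deleting vertices of $G_2\setminus\{s,t\}$ only. 3. In particular, for all sufficiently large $k$ there is a planar broadcast graph with broadcast time $k$ on more than $2^{k-1}+2^{\lfloor 2k/3\rfloor}+1$ vertices (the previous lower bound of Hell and Seyffarth). -/

import Mathlib

open Filter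

/-! ### Broadcasting -/

/-- One time unit of broadcasting: `I` is the set of informed vertices before it and `J` the set
afterwards. Every newly informed vertex `w` is called by an informed neighbour `c w`, and no
vertex makes more than one call. -/
def SimpleGraph.BroadcastStep {V : Type*} (G : SimpleGraph V) (I J : Set V) : Prop :=
  I ⊆ J ∧ ∃ c : V → V, Set.InjOn c (J \ I) ∧ ∀ w ∈ J \ I, c w ∈ I ∧ G.Adj (c w) w

/-- There is a broadcast scheme for the originator `v` that informs all vertices within `T`
time units; `I i` is the set of vertices that are informed after `i` time units. -/
def SimpleGraph.BroadcastsWithin {V : Type*} (G : SimpleGraph V) (v : V) (T : ℕ) : Prop :=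
  ∃ I : ℕ → Set V, I 0 = {v} ∧ (∀ i < T, G.BroadcastStep (I i) (I (i + 1))) ∧ I T = Set.univ

/-- The broadcast time `b(v, G)` of a vertex (`⊤` if broadcasting from `v` is impossible). -/
noncomputable def SimpleGraph.vertexBroadcastTime {V : Type*} (G : SimpleGraph V) (v : V) : ℕ∞ :=
  ⨅ (T : ℕ) (_ : G.BroadcastsWithin v T), (T : ℕ∞)

/-- The broadcast time `b(G)`, the maximum of `b(v, G)` over all vertices. -/
noncomputable def SimpleGraph.broadcastTime {V : Type*} (G : SimpleGraph V) : ℕ∞ :=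
  ⨆ v : V, G.vertexBroadcastTime v

/-- A graph on `n` vertices is a broadcast graph if `b(G) = ⌈log₂ n⌉`. -/
def SimpleGraph.IsBroadcastGraph {V : Type*} (G : SimpleGraph V) : Prop :=
  G.broadcastTime = (Nat.clog 2 (Nat.card V) : ℕ∞)

/-! ### Planarity -/

/-- A graph is planar if it can be drawn in the plane without crossings: vertices are distinct
points `p v`, every edge `e` is a simple arc `A e` joining its two end points, an arc contains no
vertex other than its ends, and two distinct arcs meet only in common ends of the two edges. -/
def SimpleGraph.IsPlanar {V : Type*} (G : SimpleGraph V) : Prop :=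
  ∃ (p : V → ℝ × ℝ) (A : Sym2 V → Set (ℝ × ℝ)),
    Function.Injective p ∧
    (∀ u v, G.Adj u v → ∃ γ : _root_.Path (p u) (p v), Function.Injective γ ∧ Set.range γ = A s(u, v)) ∧
    (∀ e ∈ G.edgeSet, ∀ w, p w ∈ A e → w ∈ e) ∧
    (∀ e ∈ G.edgeSet, ∀ f ∈ G.edgeSet, e ≠ f →
      ∀ x ∈ A e ∩ A f, ∃ w, w ∈ e ∧ w ∈ f ∧ x = p w)

/-! ### Binomial trees and Accelerated-Binomial graphs

The vertices of the binomial tree `BT_k` are coded by the numbers `v < 2 ^ k`, with root `0`.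
In step `i ≥ 1` of its construction every existing vertex `p < 2 ^ (i - 1)` gets the new child
`p + 2 ^ (i - 1)`. -/

namespace Binomial

/-- The construction step in which the vertex `v` appears, i.e. its number of binary digits
(`0` for the root). -/
def step (v : ℕ) : ℕ := Nat.size v

/-- `p` is the parent of `v` in the binomial tree. -/
def IsParent (p v : ℕ) : Prop := v ≠ 0 ∧ p + 2 ^ (step v - 1) = v

/-- `a` is a proper ancestor of `v` in the binomial tree. -/
def IsAncestor (a v : ℕ) : Prop := Relation.TransGen IsParent a v

/-- The label `⌈i / 3⌉` of a vertex that appears in step `i`. -/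
def label (v : ℕ) : ℕ := (step v + 2) / 3

/-- `a` is the closest ancestor of `v` whose label is at most `⌈i / 3⌉ - 1`, where `i` is the step
in which `v` appears. -/
def IsShortcut (a v : ℕ) : Prop :=
  IsAncestor a v ∧ label a < label v ∧
    ∀ b, IsAncestor b v → label b < label v → b = a ∨ IsAncestor b a

/-- Vertices of `B_k` and `AB_k`: `some v` for the vertices of `BT_k`, and `none` for `t`. -/
abbrev Vert (k : ℕ) : Type := Option (Fin (2 ^ k))

/-- The terminal `s`, the root of the binomial tree. -/
def s (k : ℕ) : Vert k := some ⟨0, Nat.two_pow_pos k⟩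

/-- The terminal `t`. -/
def t (k : ℕ) : Vert k := none

/-- The edges `{u, v}` of the binomial tree and the edges `{v, t}`. -/
inductive BaseEdge (k : ℕ) : Vert k → Vert k → Prop
  | tree (u v : Fin (2 ^ k)) : IsParent u v → BaseEdge k (some u) (some v)
  | apex (v : Fin (2 ^ k)) : BaseEdge k (some v) (t k)

/-- The shortcut edges. -/
inductive ShortcutEdge (k : ℕ) : Vert k → Vert k → Prop
  | mk (a v : Fin (2 ^ k)) : IsShortcut a v → ShortcutEdge k (some a) (some v)

/-- The Binomial graph `B_k`: the tree `BT_k` with all its vertices joined to `t`. -/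
def B (k : ℕ) : SimpleGraph (Vert k) := SimpleGraph.fromRel (BaseEdge k)

/-- The Accelerated-Binomial graph `AB_k`: `B_k` together with the shortcut edges. -/
def AB (k : ℕ) : SimpleGraph (Vert k) := B k ⊔ SimpleGraph.fromRel (ShortcutEdge k)

end Binomial

/-! ### Parallel composition -/

namespace Parallel

/-- Vertices of a parallel composition: those of the first graph, and those of the second graph
other than its terminals. -/
abbrev Vert (V₁ : Type*) {V₂ : Type*} (s₂ t₂ : V₂) : Type _ := V₁ ⊕ {v : V₂ // v ≠ s₂ ∧ v ≠ t₂}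

open Classical in
/-- The map of the vertices of the second graph into the parallel composition, which merges `s₂`
with `s₁` and `t₂` with `t₁`. -/
noncomputable def glue {V₁ V₂ : Type*} (s₁ t₁ : V₁) (s₂ t₂ : V₂) (v : V₂) : Vert V₁ s₂ t₂ :=
  if hs : v = s₂ then Sum.inl s₁
  else if ht : v = t₂ then Sum.inl t₁
  else Sum.inr ⟨v, hs, ht⟩

/-- The parallel composition (without multiple edges) of `G₁` with terminals `s₁, t₁` and `G₂`
with terminals `s₂, t₂`. -/
noncomputable def comp {V₁ V₂ : Type*} (G₁ : SimpleGraph V₁) (s₁ t₁ : V₁)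
    (G₂ : SimpleGraph V₂) (s₂ t₂ : V₂) : SimpleGraph (Vert V₁ s₂ t₂) :=
  G₁.map (Sum.inl : V₁ → Vert V₁ s₂ t₂) ⊔ G₂.map (glue s₁ t₁ s₂ t₂)

end Parallel

/-- The parallel composition of `AB_a` and `AB_b`, on their terminals `s` and `t`. -/
noncomputable def parallelAB (a b : ℕ) :
    SimpleGraph (Parallel.Vert (Binomial.Vert a) (Binomial.s b) (Binomial.t b)) :=
  Parallel.comp (Binomial.AB a) (Binomial.s a) (Binomial.t a)
    (Binomial.AB b) (Binomial.s b) (Binomial.t b)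

/-! Numbers code the tree so that a parent arises by deleting the leading binary digit; ancestors
are then the truncations `v % 2 ^ m`, and a shortcut truncates just below the leading octal digit.
Both factors are placed in one infinite graph `double` on `none` (the terminal `t`) and the
integers, glued at `0` (the terminal `s`). Every graph in question is the subgraph induced on some
`region p q`, so planarity and broadcasting are proved once for all of them.

Planarity: apart from `t`, all vertices go on a line so that the edges are pairwise non-crossing
arcs on one side; `t` goes on the other side. The position of `v` is an octal expansion whose digits
are those of `v`, lowest first, permuted by `digitPos`. This makes the drawing self-similar: a fan
on eight vertices with a scaled copy in each gap (`Joined.posEdge`, `PosEdge.noncrossing`). The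
second factor is the mirror image.

Broadcasting: once `t` and `0` are informed, both halves double in every time unit, because `t`
makes the call that `0` owes to the right half while `0` serves the left half
(`spreads_region_step`). Another originator first calls `t`; then a message climbs to the root along
shortcuts while `t` already seeds the right tree, so the right half loses no time. The climb takes
at most `⌈k/4⌉` units, leaving enough doublings for `2 ^ (3 * k / 4 - 1)` vertices on the left.
Callers are never farther from `0` than needed to survive deletions at the far left end. Optimality
holds because the informed set at most doubles per time unit. -/

namespace Binomial

/-! ### Ancestors and shortcuts in binomial trees -/

theorem step_eq_of_mem {v j : ℕ} (h₁ : 2 ^ j ≤ v) (h₂ : v < 2 ^ (j + 1)) : step v = j + 1 :=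
  le_antisymm (Nat.size_le.2 h₂) (Nat.lt_size.2 h₁)

theorem step_le_iff {v j : ℕ} : step v ≤ j ↔ v < 2 ^ j := Nat.size_le

theorem isParent_add_two_pow {a j : ℕ} (h : a < 2 ^ j) : IsParent a (a + 2 ^ j) := by
  have hs : step (a + 2 ^ j) = j + 1 := step_eq_of_mem (by omega) (by rw [pow_succ]; omega)
  have := Nat.two_pow_pos j
  exact ⟨by omega, by rw [hs]; rfl⟩

theorem step_bounds {v : ℕ} (h : v ≠ 0) : 2 ^ (step v - 1) ≤ v ∧ v < 2 * 2 ^ (step v - 1) := by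
  have h0 : 0 < step v := Nat.size_pos.2 (Nat.pos_of_ne_zero h)
  refine ⟨Nat.lt_size.1 (show step v - 1 < step v by omega), ?_⟩
  rw [mul_comm, ← pow_succ, Nat.sub_add_cancel h0]
  exact Nat.lt_size_self v

theorem isParent_iff {p v : ℕ} : IsParent p v ↔ v ≠ 0 ∧ p = v % 2 ^ (step v - 1) := by
  refine and_congr_right fun h => ?_
  obtain ⟨h₁, h₂⟩ := step_bounds h
  rw [Nat.mod_eq_sub_mod h₁, Nat.mod_eq_of_lt (by omega)]
  omega

theorem IsParent.lt {p v : ℕ} (h : IsParent p v) : p < v := by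
  have := Nat.two_pow_pos (step v - 1)
  have := h.2
  omega

theorem mod_two_pow_mod_two_pow (v m n : ℕ) : v % 2 ^ m % 2 ^ n = v % 2 ^ min m n := by
  rcases le_total m n with h | h
  · rw [min_eq_left h, Nat.mod_eq_of_lt]
    exact (Nat.mod_lt _ (Nat.two_pow_pos m)).trans_le (Nat.pow_le_pow_right two_pos h)
  · rw [min_eq_right h, Nat.mod_mod_of_dvd _ (pow_dvd_pow 2 h)]

/-- Passing to the parent deletes the leading binary digit, so iterating it yields exactly the
proper truncations to low digits. -/
theorem isAncestor_iff {a v : ℕ} : IsAncestor a v ↔ a < v ∧ ∃ m, a = v % 2 ^ m := by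
  constructor
  · intro h
    induction h with
    | single h => exact ⟨h.lt, _, (isParent_iff.1 h).2⟩
    | tail _ h ih =>
      obtain ⟨h₁, m, h₂⟩ := ih
      exact ⟨h₁.trans h.lt, _, by rw [h₂, (isParent_iff.1 h).2, mod_two_pow_mod_two_pow]⟩
  · induction v using Nat.strong_induction_on with
    | _ v ih =>
      rintro ⟨h, m, hm⟩
      have hp : IsParent (v % 2 ^ (step v - 1)) v := isParent_iff.2 ⟨by omega, rfl⟩
      have hms : m ≤ step v - 1 := by
        by_contra hlt
        have : v < 2 ^ m := step_le_iff.1 (by omega)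
        rw [Nat.mod_eq_of_lt this] at hm
        omega
      have ha : a = v % 2 ^ (step v - 1) % 2 ^ m := by
        rw [mod_two_pow_mod_two_pow, min_eq_right hms, hm]
      rcases eq_or_ne a (v % 2 ^ (step v - 1)) with he | he
      · exact .single (he ▸ hp)
      · exact .tail (ih _ hp.lt ⟨lt_of_le_of_ne (ha ▸ Nat.mod_le _ _) he, m, ha⟩) hp

/-- The closest ancestor of `v` with a smaller label (and `0` for `v = 0`). -/
def shortcut (v : ℕ) : ℕ := v % 2 ^ (3 * (label v - 1))

theorem label_le_iff {v l : ℕ} : label v ≤ l ↔ v < 2 ^ (3 * l) := by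
  rw [← step_le_iff, label]
  omega

theorem label_shortcut_le (v : ℕ) : label (shortcut v) ≤ label v - 1 :=
  label_le_iff.2 (Nat.mod_lt _ (Nat.two_pow_pos _))

theorem label_pos {v : ℕ} (h : v ≠ 0) : 0 < label v := by
  have : 0 < step v := Nat.size_pos.2 (Nat.pos_of_ne_zero h)
  rw [label]
  omega

theorem shortcut_lt {v : ℕ} (h : v ≠ 0) : shortcut v < v := by
  refine lt_of_le_of_ne (Nat.mod_le _ _) fun he => ?_
  have h₁ := label_shortcut_le v
  have h₂ := label_pos h
  rw [he] at h₁
  omega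

theorem shortcut_le (v : ℕ) : shortcut v ≤ v := Nat.mod_le _ _

/-- The label counts octal digits. An ancestor with fewer octal digits is a truncation of `v` that
fits below the leading one, hence a truncation of `shortcut v`. -/
theorem isShortcut_shortcut {v : ℕ} (h : v ≠ 0) : IsShortcut (shortcut v) v := by
  have h₁ := label_shortcut_le v
  have h₂ := label_pos h
  refine ⟨isAncestor_iff.2 ⟨shortcut_lt h, _, rfl⟩, by omega, fun b hb hl => ?_⟩
  obtain ⟨-, m, hm⟩ := isAncestor_iff.1 hb
  have hb' : b < 2 ^ (3 * (label v - 1)) := label_le_iff.1 (by omega)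
  have hbs : b = shortcut v % 2 ^ m := by
    rw [shortcut, mod_two_pow_mod_two_pow, min_comm, ← mod_two_pow_mod_two_pow, ← hm,
      Nat.mod_eq_of_lt hb']
  rcases eq_or_ne b (shortcut v) with he | he
  · exact .inl he
  · exact .inr (isAncestor_iff.2 ⟨lt_of_le_of_ne (hbs ▸ Nat.mod_le _ _) he, m, hbs⟩)

theorem IsAncestor.asymm {a b : ℕ} (h : IsAncestor a b) : ¬ IsAncestor b a := fun h' => by
  have := (isAncestor_iff.1 h).1
  have := (isAncestor_iff.1 h').1
  omega

theorem IsShortcut.ne_zero {a v : ℕ} (h : IsShortcut a v) : v ≠ 0 := by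
  have := (isAncestor_iff.1 h.1).1
  omega

theorem IsShortcut.eq_shortcut {a v : ℕ} (h : IsShortcut a v) : a = shortcut v := by
  have h' := isShortcut_shortcut h.ne_zero
  rcases h.2.2 _ h'.1 h'.2.1 with h₁ | h₁
  · exact h₁.symm
  · rcases h'.2.2 _ h.1 h.2.1 with h₂ | h₂
    · exact h₂
    · exact absurd h₂ h₁.asymm

/-- `p` and `v` span a tree edge or a shortcut edge, where `p` is the endpoint nearer to the
root. -/
def Joined (p v : ℕ) : Prop := IsParent p v ∨ IsShortcut p v

theorem Joined.lt {p v : ℕ} (h : Joined p v) : p < v :=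
  h.elim IsParent.lt fun h => (isAncestor_iff.1 h.1).1

/-! ### A one-page drawing of binomial trees with shortcuts -/

/-- The place of the octal digit `d` in the drawing of a single fan. -/
def digitPos : ℕ → ℕ
  | 1 => 2 | 2 => 5 | 3 => 3 | 4 => 7 | 5 => 1 | 6 => 6 | 7 => 4 | _ => 0

theorem digitPos_le (d : ℕ) : digitPos d ≤ 7 := by
  unfold digitPos; split <;> omega

theorem digitPos_inj {d e : ℕ} (hd : d < 8) (he : e < 8) (h : digitPos d = digitPos e) :
    d = e := by
  have key : ∀ d < 8, ∀ e < 8, digitPos d = digitPos e → d = e := by decide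
  exact key d hd e he h

/-- The position of the vertex `v` on the line. -/
noncomputable def pos (v : ℕ) : ℝ :=
  if v = 0 then 0 else (digitPos (v % 8) + pos (v / 8)) / 8
decreasing_by omega

theorem pos_zero : pos 0 = 0 := by rw [pos, if_pos rfl]

theorem pos_eq (v : ℕ) : pos v = (digitPos (v % 8) + pos (v / 8)) / 8 := by
  rcases eq_or_ne v 0 with rfl | h
  · simp [pos_zero, digitPos]
  · rw [pos, if_neg h]

theorem pos_mem (v : ℕ) : 0 ≤ pos v ∧ pos v < 1 := by
  induction v using Nat.strong_induction_on with
  | _ v ih =>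
    rcases eq_or_ne v 0 with rfl | h
    · simp [pos_zero]
    · obtain ⟨h₁, h₂⟩ := ih (v / 8) (by omega)
      have h₃ : (digitPos (v % 8) : ℝ) ≤ 7 := mod_cast digitPos_le _
      have h₄ : (0 : ℝ) ≤ digitPos (v % 8) := Nat.cast_nonneg _
      rw [pos_eq]
      constructor <;> linarith

/-- Since the tail of the expansion lies in `[0, 1)`, the leading place and the tail can be read off
from the position, and `digitPos` is injective on digits. -/
theorem pos_injective : Function.Injective pos := by
  have key : ∀ {a b : ℕ} {x y : ℝ}, (a + x) / 8 = (b + y) / 8 → 0 ≤ x → y < 1 → a ≤ b := by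
    intro a b x y h hx hy
    by_contra hlt
    have : (b : ℝ) + 1 ≤ a := mod_cast (by omega : b + 1 ≤ a)
    linarith
  suffices ∀ n u v : ℕ, u ≤ n → v ≤ n → pos u = pos v → u = v from
    fun u v => this (max u v) u v (le_max_left _ _) (le_max_right _ _)
  intro n
  induction n with
  | zero => intros; omega
  | succ n ih =>
    intro u v hu hv h
    rw [pos_eq u, pos_eq v] at h
    have hd := le_antisymm (key h (pos_mem _).1 (pos_mem _).2)
      (key h.symm (pos_mem _).1 (pos_mem _).2)
    rw [hd] at h
    have := digitPos_inj (Nat.mod_lt u (by norm_num)) (Nat.mod_lt v (by norm_num)) hd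
    have := ih (u / 8) (v / 8) (by omega) (by omega) (by linarith)
    omega

/-- The edges of the drawing, from left to right. -/
inductive PosEdge : ℕ → ℕ → Prop
  | fan (u v : ℕ) : u < 8 → v < 8 → digitPos u < digitPos v →
      (digitPos u = 0 ∨ digitPos v = digitPos u + 1) → PosEdge u v
  | lift (u v : ℕ) : u % 8 = v % 8 → PosEdge (u / 8) (v / 8) → PosEdge u v

theorem pos_of_lt_eight {v : ℕ} (h : v < 8) : pos v = digitPos v / 8 := by
  rw [pos_eq, Nat.mod_eq_of_lt h, Nat.div_eq_of_lt h, pos_zero, add_zero]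

theorem PosEdge.pos_lt {u v : ℕ} (h : PosEdge u v) : pos u < pos v := by
  induction h with
  | fan u v hu hv h _ =>
    have : (digitPos u : ℝ) < digitPos v := mod_cast h
    rw [pos_of_lt_eight hu, pos_of_lt_eight hv]
    linarith
  | lift u v h _ ih =>
    rw [pos_eq u, pos_eq v, h]
    linarith

/-- The intervals `[a, b]` and `[c, d]` do not cross. -/
def Noncrossing (a b c d : ℝ) : Prop := b ≤ c ∨ d ≤ a ∨ (a ≤ c ∧ d ≤ b) ∨ (c ≤ a ∧ b ≤ d)

theorem Noncrossing.symm {a b c d : ℝ} (h : Noncrossing a b c d) : Noncrossing c d a b := by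
  unfold Noncrossing at *
  tauto

/-- Ends of fan edges sit at multiples of `1/8`, whereas vertices with a common lowest octal digit
share one interval `[e/8, (e+1)/8)`. -/
theorem noncrossing_fan_lift {u v u' v' : ℕ} (hu : u < 8) (hv : v < 8) (h : u' % 8 = v' % 8) :
    Noncrossing (pos u) (pos v) (pos u') (pos v') := by
  obtain ⟨h₁, h₂⟩ := pos_mem (u' / 8)
  obtain ⟨h₃, h₄⟩ := pos_mem (v' / 8)
  rw [pos_of_lt_eight hu, pos_of_lt_eight hv, pos_eq u', pos_eq v', h]
  generalize digitPos (v' % 8) = e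
  generalize digitPos u = a
  generalize digitPos v = b
  unfold Noncrossing
  rcases Nat.lt_or_ge e b with hb | hb
  · have : (e : ℝ) + 1 ≤ b := mod_cast hb
    rcases Nat.lt_or_ge e a with ha | ha
    · have : (e : ℝ) + 1 ≤ a := mod_cast ha
      right; left; linarith
    · have : (a : ℝ) ≤ e := mod_cast ha
      right; right; left; constructor <;> linarith
  · have : (b : ℝ) ≤ e := mod_cast hb
    left; linarith

/-- Two lifted edges either lie in different eighths of the line or in the same one, where they form
a scaled copy of a smaller pair. -/
theorem PosEdge.noncrossing {u v u' v' : ℕ} (h : PosEdge u v) (h' : PosEdge u' v') :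
    Noncrossing (pos u) (pos v) (pos u') (pos v') := by
  induction h generalizing u' v' with
  | fan u v hu hv hlt hc =>
    cases h' with
    | fan _ _ hu' hv' hlt' hc' =>
      rw [pos_of_lt_eight hu, pos_of_lt_eight hv, pos_of_lt_eight hu', pos_of_lt_eight hv']
      unfold Noncrossing
      simp only [div_le_div_iff_of_pos_right (by norm_num : (0 : ℝ) < 8), Nat.cast_le]
      omega
    | lift _ _ hd _ => exact noncrossing_fan_lift hu hv hd
  | lift u v hd he ih =>
    cases h' with
    | fan _ _ hu' hv' _ _ => exact (noncrossing_fan_lift hu' hv' hd).symm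
    | lift _ _ hd' he' =>
      have hi := ih he'
      rw [pos_eq u, pos_eq v, pos_eq u', pos_eq v', hd, hd']
      obtain ⟨h₁, h₂⟩ := pos_mem (u / 8)
      obtain ⟨h₃, h₄⟩ := pos_mem (v / 8)
      obtain ⟨h₅, h₆⟩ := pos_mem (u' / 8)
      obtain ⟨h₇, h₈⟩ := pos_mem (v' / 8)
      generalize digitPos (v % 8) = a
      generalize digitPos (v' % 8) = b
      unfold Noncrossing at *
      rcases lt_trichotomy a b with h | rfl | h
      · have : (a : ℝ) + 1 ≤ b := mod_cast h
        left; linarith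
      · simpa [div_le_div_iff_of_pos_right (by norm_num : (0 : ℝ) < 8)] using hi
      · have : (b : ℝ) + 1 ≤ a := mod_cast h
        right; left; linarith

theorem step_div_eight {v : ℕ} (h : 8 ≤ v) : step v = step (v / 8) + 3 := by
  have h0 : v / 8 ≠ 0 := by omega
  have h₁ : 0 < step (v / 8) := Nat.size_pos.2 (by omega)
  obtain ⟨h₂, h₃⟩ := step_bounds h0
  rw [show step (v / 8) + 3 = step (v / 8) - 1 + 3 + 1 by omega]
  apply step_eq_of_mem
  · rw [pow_add]; omega
  · rw [pow_succ, pow_add]; omega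

theorem mod_two_pow_add_three (v m : ℕ) :
    v % 2 ^ (m + 3) % 8 = v % 8 ∧ v % 2 ^ (m + 3) / 8 = v / 8 % 2 ^ m := by
  constructor
  · exact Nat.mod_mod_of_dvd _ (show 2 ^ 3 ∣ 2 ^ (m + 3) from pow_dvd_pow 2 (by omega))
  · rw [pow_add, mul_comm]
    exact Nat.mod_mul_right_div_self _ _ _

/-- Below `8`, the edges join `0` to everything, plus 5–1, 1–3, 3–7 and 2–6; the order 0, 5, 1, 3,
7, 2, 6, 4 given by `digitPos` makes these four pairs consecutive. For `v ≥ 8` both kinds of edge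
preserve the lowest octal digit, and deleting it from both ends gives an edge again. -/
theorem Joined.posEdge {p v : ℕ} (h : Joined p v) : PosEdge p v ∨ PosEdge v p := by
  induction v using Nat.strong_induction_on generalizing p with
  | _ v ih =>
    rcases Nat.lt_or_ge v 8 with hv | hv
    · have hp := h.lt.trans hv
      have : (digitPos p = 0 ∧ 0 < digitPos v) ∨ digitPos v = digitPos p + 1 ∨
          digitPos p = digitPos v + 1 := by
        rcases h with h | h
        · have h0 := h.1
          have := (isParent_iff.1 h).2
          subst this
          clear h ih hp
          revert h0; revert v; decide
        · have h0 := h.ne_zero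
          have := h.eq_shortcut
          subst this
          clear h ih hp
          revert h0; revert v; decide
      rcases this with ⟨h₁, h₂⟩ | h₁ | h₁
      · exact .inl (.fan _ _ hp hv (by omega) (.inl h₁))
      · exact .inl (.fan _ _ hp hv (by omega) (.inr h₁))
      · exact .inr (.fan _ _ hv hp (by omega) (.inr h₁))
    · have hs := step_div_eight hv
      have h0 : v / 8 ≠ 0 := by omega
      have h₁ : 0 < step (v / 8) := Nat.size_pos.2 (by omega)
      have hl : label v = label (v / 8) + 1 := by rw [label, label]; omega
      have h₂ := label_pos h0
      suffices p % 8 = v % 8 ∧ Joined (p / 8) (v / 8) by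
        rcases ih (v / 8) (by omega) this.2 with h | h
        · exact .inl (.lift _ _ this.1 h)
        · exact .inr (.lift _ _ this.1.symm h)
      rcases h with h | h
      · have h := (isParent_iff.1 h).2
        rw [show step v - 1 = step (v / 8) - 1 + 3 by omega] at h
        obtain ⟨h₃, h₄⟩ := mod_two_pow_add_three v (step (v / 8) - 1)
        rw [← h] at h₃ h₄
        exact ⟨h₃, .inl (isParent_iff.2 ⟨h0, h₄⟩)⟩
      · have h := h.eq_shortcut
        rw [shortcut, show 3 * (label v - 1) = 3 * (label (v / 8) - 1) + 3 by omega] at h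
        obtain ⟨h₃, h₄⟩ := mod_two_pow_add_three v (3 * (label (v / 8) - 1))
        rw [← h] at h₃ h₄
        refine ⟨h₃, .inr ?_⟩
        rw [h₄]
        exact isShortcut_shortcut h0

end Binomial

namespace SimpleGraph

/-! ### Planarity -/

theorem IsPlanar.of_embedding {V W : Type*} {G : SimpleGraph V} {H : SimpleGraph W}
    (h : G.IsPlanar) (f : H ↪g G) : H.IsPlanar := by
  obtain ⟨p, A, hp, hA, hv, he⟩ := h
  have hmem : ∀ e ∈ H.edgeSet, e.map f ∈ G.edgeSet := by
    intro e
    induction e using Sym2.ind with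
    | _ u v => exact fun h => f.map_adj_iff.2 h
  refine ⟨p ∘ f, fun e => A (e.map f), hp.comp f.injective, fun u v h => ?_, fun e h w hw => ?_,
    fun e h e' h' hne x hx => ?_⟩
  · exact hA _ _ (f.map_adj_iff.2 h)
  · obtain ⟨w', hw', h'⟩ := Sym2.mem_map.1 (hv _ (hmem e h) _ hw)
    rwa [← f.injective h']
  · obtain ⟨w, h₁, h₂, h₃⟩ := he _ (hmem e h) _ (hmem e' h')
      (fun h => hne (Sym2.map.injective f.injective h)) x hx
    obtain ⟨w₁, hw₁, rfl⟩ := Sym2.mem_map.1 h₁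
    obtain ⟨w₂, hw₂, h₄⟩ := Sym2.mem_map.1 h₂
    rw [f.injective h₄] at hw₂
    exact ⟨w₁, hw₁, hw₂, h₃⟩

/-- The arc from `(x, 0)` to `(y, 0)` along a parabola. -/
noncomputable def parabola (x y : ℝ) : _root_.Path ((x, 0) : ℝ × ℝ) (y, 0) where
  toFun r := (x + r * (y - x), r * (1 - r) * (y - x) ^ 2)
  continuous_toFun := by fun_prop
  source' := by simp
  target' := by simp

theorem parabola_injective {x y : ℝ} (h : x ≠ y) : Function.Injective (parabola x y) := by
  intro r r' hr
  have h₁ : x + r * (y - x) = x + r' * (y - x) := congrArg Prod.fst hr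
  exact Subtype.ext (mul_right_cancel₀ (sub_ne_zero.2 h.symm) (add_left_cancel h₁))

theorem range_parabola {x y : ℝ} (h : x < y) : Set.range (parabola x y) =
    {q | (x ≤ q.1 ∧ q.1 ≤ y) ∧ q.2 = (q.1 - x) * (y - q.1)} := by
  have h' : 0 < y - x := sub_pos.2 h
  ext ⟨a, b⟩
  constructor
  · rintro ⟨⟨r, h₀, h₁⟩, hr⟩
    have ha : x + r * (y - x) = a := congrArg Prod.fst hr
    have hb : r * (1 - r) * (y - x) ^ 2 = b := congrArg Prod.snd hr
    subst ha hb
    refine ⟨⟨?_, ?_⟩, ?_⟩ <;> dsimp only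
    · nlinarith
    · nlinarith
    · ring
  · rintro ⟨⟨h₀, h₁⟩, hb⟩
    dsimp only at h₀ h₁ hb
    refine ⟨⟨(a - x) / (y - x), by apply div_nonneg <;> linarith,
      (div_le_one h').2 (by linarith)⟩, Prod.ext ?_ ?_⟩
    · change x + (a - x) / (y - x) * (y - x) = a
      field_simp
      ring
    · change (a - x) / (y - x) * (1 - (a - x) / (y - x)) * (y - x) ^ 2 = b
      rw [hb]
      field_simp
      ring

/-- The segment from `(0, -1)` to `(x, 0)`. -/
noncomputable def spoke (x : ℝ) : _root_.Path ((0, -1) : ℝ × ℝ) (x, 0) where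
  toFun r := (r * x, r - 1)
  continuous_toFun := by fun_prop
  source' := by simp
  target' := by simp

theorem spoke_injective (x : ℝ) : Function.Injective (spoke x) := by
  intro r r' hr
  have h₁ : (r : ℝ) - 1 = r' - 1 := congrArg Prod.snd hr
  exact Subtype.ext (by linarith)

theorem range_spoke (x : ℝ) : Set.range (spoke x) =
    {q | (-1 ≤ q.2 ∧ q.2 ≤ 0) ∧ q.1 = (q.2 + 1) * x} := by
  ext ⟨a, b⟩
  constructor
  · rintro ⟨⟨r, h₀, h₁⟩, hr⟩
    have ha : r * x = a := congrArg Prod.fst hr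
    have hb : r - 1 = b := congrArg Prod.snd hr
    subst ha hb
    exact ⟨⟨by dsimp only; linarith, by dsimp only; linarith⟩, by dsimp only; ring⟩
  · rintro ⟨⟨h₀, h₁⟩, ha⟩
    dsimp only at h₀ h₁ ha
    exact ⟨⟨b + 1, by linarith, by linarith⟩, Prod.ext ha.symm (by simp [spoke])⟩

/-- For nested intervals the height difference of the parabolas is `(x' - x) * (y - z) + (z - x') *
(y - y')`, a sum of nonnegative terms, so at a common point both vanish. -/
theorem noncrossing_meet {x y x' y' z : ℝ} (hz : x ≤ z ∧ z ≤ y) (hz' : x' ≤ z ∧ z ≤ y')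
    (hlt : x < y) (hlt' : x' < y') (hn : Binomial.Noncrossing x y x' y')
    (he : (z - x) * (y - z) = (z - x') * (y' - z)) :
    (x = x' ∧ y = y') ∨ (z = x ∨ z = y) ∧ (z = x' ∨ z = y') := by
  have key : ∀ {x y x' y' : ℝ}, x ≤ z ∧ z ≤ y → x' ≤ z ∧ z ≤ y' → x < y → x' < y' → x ≤ x' →
      y' ≤ y → (z - x) * (y - z) = (z - x') * (y' - z) →
      (x = x' ∧ y = y') ∨ (z = x ∨ z = y) ∧ (z = x' ∨ z = y') := by
    intro x y x' y' hz hz' hlt hlt' h₁ h₂ he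
    have e : (x' - x) * (y - z) + (z - x') * (y - y') = 0 := by linarith
    have e₁ : 0 ≤ (x' - x) * (y - z) := mul_nonneg (by linarith) (by linarith)
    have e₂ : 0 ≤ (z - x') * (y - y') := mul_nonneg (by linarith) (by linarith)
    have f₁ : (x' - x) * (y - z) = 0 := by linarith
    have f₂ : (z - x') * (y - y') = 0 := by linarith
    rcases mul_eq_zero.1 f₁ with g₁ | g₁ <;> rcases mul_eq_zero.1 f₂ with g₂ | g₂
    · exact .inr ⟨.inl (by linarith), .inl (by linarith)⟩
    · exact .inl ⟨by linarith, by linarith⟩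
    · linarith
    · exact .inr ⟨.inr (by linarith), .inr (by linarith)⟩
  rcases hn with h | h | ⟨h₁, h₂⟩ | ⟨h₁, h₂⟩
  · exact .inr ⟨.inr (by linarith), .inl (by linarith)⟩
  · exact .inr ⟨.inl (by linarith), .inr (by linarith)⟩
  · exact key hz hz' hlt hlt' h₁ h₂ he
  · rcases key hz' hz hlt' hlt h₁ h₂ he.symm with ⟨h, h'⟩ | ⟨h, h'⟩
    · exact .inl ⟨h.symm, h'.symm⟩
    · exact .inr ⟨h', h⟩

/-- A graph is planar if all but one of its vertices can be put on a line such that no two edges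
between them cross when they are drawn on the same side of the line. -/
theorem isPlanar_of_noncrossing {U : Type*} (G : SimpleGraph (Option U)) (X : U → ℝ)
    (hX : Function.Injective X)
    (h : ∀ a b c d, G.Adj (some a) (some b) → G.Adj (some c) (some d) → X a < X b → X c < X d →
      Binomial.Noncrossing (X a) (X b) (X c) (X d)) : G.IsPlanar := by
  let p : Option U → ℝ × ℝ := fun o => o.elim (0, -1) fun u => (X u, 0)
  let A : Sym2 (Option U) → Set (ℝ × ℝ) := fun e =>
    {q | (∃ u, e = s(none, some u) ∧ q ∈ Set.range (spoke (X u))) ∨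
      ∃ u v, X u < X v ∧ e = s(some u, some v) ∧ q ∈ Set.range (parabola (X u) (X v))}
  have hp : Function.Injective p := by
    rintro (_ | u) (_ | v) huv
    · rfl
    · simp [p] at huv
    · simp [p] at huv
    · rw [hX (congrArg Prod.fst huv)]
  have hspoke : ∀ u, A s(none, some u) = Set.range (spoke (X u)) := by
    intro u
    ext q
    constructor
    · rintro (⟨v, hv, hq⟩ | ⟨v, w, -, hv, -⟩)
      · simp only [Sym2.eq_iff, Option.some.injEq, true_and, reduceCtorEq, false_and,
          or_false] at hv
        exact hv ▸ hq
      · simp at hv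
    · exact fun hq => .inl ⟨u, rfl, hq⟩
  have hpar : ∀ u v, X u < X v → A s(some u, some v) = Set.range (parabola (X u) (X v)) := by
    intro u v huv
    ext q
    constructor
    · rintro (⟨w, hw, hq⟩ | ⟨u', v', hlt, hv, hq⟩)
      · simp at hw
      · simp only [Sym2.eq_iff, Option.some.injEq] at hv
        rcases hv with ⟨rfl, rfl⟩ | ⟨rfl, rfl⟩
        · exact hq
        · exact absurd huv hlt.asymm
    · exact fun hq => .inr ⟨u, v, huv, rfl, hq⟩
  have hcases : ∀ e ∈ G.edgeSet, (∃ u, e = s(none, some u)) ∨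
      ∃ u v, X u < X v ∧ G.Adj (some u) (some v) ∧ e = s(some u, some v) := by
    intro e
    induction e using Sym2.ind with
    | _ u v =>
      intro huv
      rw [mem_edgeSet] at huv
      rcases u with _ | u <;> rcases v with _ | v
      · exact absurd rfl huv.ne
      · exact .inl ⟨v, rfl⟩
      · exact .inl ⟨u, Sym2.eq_swap⟩
      · have hne : X u ≠ X v := fun h => huv.ne (congrArg some (hX h))
        rcases hne.lt_or_gt with h | h
        · exact .inr ⟨u, v, h, huv, rfl⟩
        · exact .inr ⟨v, u, h, huv.symm, Sym2.eq_swap⟩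
  -- Spokes stay on or below the axis and parabolas on or above it, so they can only meet on the
  -- axis, at a vertex.
  have hmeet : ∀ u a b, X a < X b → ∀ q ∈ Set.range (spoke (X u)),
      q ∈ Set.range (parabola (X a) (X b)) → (u = a ∨ u = b) ∧ q = p (some u) := by
    intro u a b hab q hq hq'
    rw [range_spoke] at hq
    rw [range_parabola hab] at hq'
    obtain ⟨⟨-, h₁⟩, h₂⟩ := hq
    obtain ⟨⟨h₃, h₄⟩, h₅⟩ := hq'
    have h₆ : 0 ≤ q.2 := h₅ ▸ mul_nonneg (by linarith) (by linarith)
    have h₇ : q.2 = 0 := le_antisymm h₁ h₆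
    rw [h₇, zero_add, one_mul] at h₂
    rw [h₇, eq_comm, mul_eq_zero, h₂] at h₅
    refine ⟨?_, Prod.ext h₂ h₇⟩
    rcases h₅ with h | h
    · exact .inl (hX (by linarith))
    · exact .inr (hX (by linarith))
  refine ⟨p, A, hp, ?_, ?_, ?_⟩
  · rintro (_ | u) (_ | v) huv
    · exact absurd rfl huv.ne
    · exact ⟨spoke (X v), spoke_injective _, (hspoke v).symm⟩
    · refine ⟨(spoke (X u)).symm, (spoke_injective _).comp unitInterval.symm_bijective.injective,
        ?_⟩
      exact (_root_.Path.symm_range _).trans (by rw [Sym2.eq_swap, hspoke])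
    · have hne : X u ≠ X v := fun h => huv.ne (congrArg some (hX h))
      rcases hne.lt_or_gt with h | h
      · exact ⟨parabola (X u) (X v), parabola_injective hne, (hpar _ _ h).symm⟩
      · refine ⟨(parabola (X v) (X u)).symm,
          (parabola_injective hne.symm).comp unitInterval.symm_bijective.injective, ?_⟩
        exact (_root_.Path.symm_range _).trans (by rw [Sym2.eq_swap, hpar _ _ h])
  · intro e he w hw
    rcases hcases e he with ⟨u, rfl⟩ | ⟨u, v, huv, -, rfl⟩
    · rcases w with _ | w
      · exact Sym2.mem_mk_left _ _
      · rw [hspoke, range_spoke] at hw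
        have h₁ : X w = (0 + 1) * X u := hw.2
        rw [hX (by linarith : X w = X u)]
        exact Sym2.mem_mk_right _ _
    · rw [hpar _ _ huv, range_parabola huv] at hw
      rcases w with _ | w
      · obtain ⟨⟨h₁, h₂⟩, h₃⟩ := hw
        have h₁ : X u ≤ 0 := h₁
        have h₂ : 0 ≤ X v := h₂
        have h₃ : (-1 : ℝ) = (0 - X u) * (X v - 0) := h₃
        nlinarith
      · have h₃ : (0 : ℝ) = (X w - X u) * (X v - X w) := hw.2
        rw [Sym2.mem_iff]
        rcases mul_eq_zero.1 h₃.symm with h | h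
        · exact .inl (congrArg some (hX (by linarith)))
        · exact .inr (congrArg some (hX (by linarith)))
  · rintro e he f hf hne q ⟨hq, hq'⟩
    rcases hcases e he with ⟨u, rfl⟩ | ⟨u, v, huv, hadj, rfl⟩ <;>
      rcases hcases f hf with ⟨u', rfl⟩ | ⟨u', v', huv', hadj', rfl⟩
    · rw [hspoke, range_spoke] at hq hq'
      refine ⟨none, Sym2.mem_mk_left _ _, Sym2.mem_mk_left _ _, ?_⟩
      have h₁ : X u - X u' ≠ 0 := fun h => hne (by rw [hX (by linarith : X u = X u')])
      have h₂ : (q.2 + 1) * (X u - X u') = 0 := by linarith [hq.2, hq'.2]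
      have h₃ : q.2 + 1 = 0 := (mul_eq_zero.1 h₂).resolve_right h₁
      refine Prod.ext ?_ (by change q.2 = -1; linarith)
      rw [hq.2, h₃, zero_mul]
      rfl
    · rw [hspoke] at hq
      rw [hpar _ _ huv'] at hq'
      obtain ⟨h₁ | h₁, h₂⟩ := hmeet _ _ _ huv' _ hq hq' <;> subst h₁
      · exact ⟨some u, Sym2.mem_mk_right _ _, Sym2.mem_mk_left _ _, h₂⟩
      · exact ⟨some u, Sym2.mem_mk_right _ _, Sym2.mem_mk_right _ _, h₂⟩
    · rw [hspoke] at hq'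
      rw [hpar _ _ huv] at hq
      obtain ⟨h₁ | h₁, h₂⟩ := hmeet _ _ _ huv _ hq' hq <;> subst h₁
      · exact ⟨some u', Sym2.mem_mk_left _ _, Sym2.mem_mk_right _ _, h₂⟩
      · exact ⟨some u', Sym2.mem_mk_right _ _, Sym2.mem_mk_right _ _, h₂⟩
    · rw [hpar _ _ huv, range_parabola huv] at hq
      rw [hpar _ _ huv', range_parabola huv'] at hq'
      rcases noncrossing_meet hq.1 hq'.1 huv huv' (h _ _ _ _ hadj hadj' huv huv')
        (hq.2.symm.trans hq'.2) with ⟨h₁, h₂⟩ | ⟨h₁, h₂⟩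
      · exact absurd (by rw [hX h₁, hX h₂]) hne
      · have h₀ : q.2 = 0 := by
          rw [hq.2]
          rcases h₁ with h₁ | h₁ <;> rw [h₁] <;> ring
        have hend : ∀ {a b : U}, q.1 = X a ∨ q.1 = X b → ∃ w, q = p (some w) ∧
            (some w ∈ s(some a, some b)) := by
          rintro a b (h | h)
          · exact ⟨a, Prod.ext h h₀, Sym2.mem_mk_left _ _⟩
          · exact ⟨b, Prod.ext h h₀, Sym2.mem_mk_right _ _⟩
        obtain ⟨w, hw, hw₁⟩ := hend h₁
        obtain ⟨w', hw', hw₂⟩ := hend h₂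
        rw [← hp (hw.symm.trans hw')] at hw₂
        exact ⟨some w, hw₁, hw₂, hw⟩

/-! ### Broadcasting -/

/-- Once the vertices of `A` are informed, those of `B` can be informed within `n` time units. -/
def Spreads {V : Type*} (G : SimpleGraph V) : ℕ → Set V → Set V → Prop
  | 0, A, B => B ⊆ A
  | n + 1, A, B => ∃ C, G.BroadcastStep A C ∧ G.Spreads n C B

variable {V W : Type*} {G : SimpleGraph V}

theorem BroadcastStep.mono {A A' C : Set V} (h : G.BroadcastStep A C) (hA : A ⊆ A') :
    G.BroadcastStep A' (A' ∪ C) := by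
  obtain ⟨-, c, hc, hc'⟩ := h
  have hsub : (A' ∪ C) \ A' ⊆ C \ A := fun x hx =>
    ⟨hx.1.resolve_left hx.2, fun h => hx.2 (hA h)⟩
  exact ⟨Set.subset_union_left, c, hc.mono hsub,
    fun w hw => ⟨hA (hc' w (hsub hw)).1, (hc' w (hsub hw)).2⟩⟩

theorem Spreads.mono {n : ℕ} {A A' B : Set V} (h : G.Spreads n A B) (hA : A ⊆ A') :
    G.Spreads n A' B := by
  induction n generalizing A A' with
  | zero => exact h.trans hA
  | succ n ih =>
    obtain ⟨C, h₁, h₂⟩ := h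
    exact ⟨_, h₁.mono hA, ih h₂ Set.subset_union_right⟩

theorem Spreads.trans {m n : ℕ} {A B C : Set V} (h : G.Spreads m A B) (h' : G.Spreads n B C) :
    G.Spreads (m + n) A C := by
  induction m generalizing A with
  | zero => rw [zero_add]; exact h'.mono h
  | succ m ih =>
    obtain ⟨D, h₁, h₂⟩ := h
    rw [Nat.succ_add]
    exact ⟨D, h₁, ih h₂⟩

theorem Spreads.iterate {F : ℕ → Set V} {m n : ℕ} (hmn : m ≤ n)
    (h : ∀ i, m ≤ i → i < n → G.Spreads 1 (F i) (F (i + 1))) : G.Spreads (n - m) (F m) (F n) := by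
  induction n, hmn using Nat.le_induction with
  | base => rw [Nat.sub_self]; exact subset_rfl
  | succ n hn ih =>
    rw [Nat.succ_sub hn]
    exact (ih fun i h₁ h₂ => h i h₁ (by omega)).trans (h n hn (Nat.lt_succ_self n))

theorem Spreads.broadcastsWithin {n : ℕ} {v : V} (h : G.Spreads n {v} Set.univ) :
    G.BroadcastsWithin v n := by
  suffices ∀ A, G.Spreads n A Set.univ → ∃ I : ℕ → Set V, I 0 = A ∧
      (∀ i < n, G.BroadcastStep (I i) (I (i + 1))) ∧ I n = Set.univ from this _ h
  clear h
  induction n with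
  | zero => exact fun A h => ⟨fun _ => A, rfl, by simp, Set.univ_subset_iff.1 h⟩
  | succ n ih =>
    rintro A ⟨C, h₁, h₂⟩
    obtain ⟨I, h₃, h₄, h₅⟩ := ih C h₂
    refine ⟨fun i => i.casesOn A I, rfl, fun i hi => ?_, h₅⟩
    cases i with
    | zero => change G.BroadcastStep A (I 0); rwa [h₃]
    | succ i => exact h₄ i (by omega)

/-- A step in which every informed vertex `x` calls `f x`, in a graph embedded into `Γ`. -/
theorem spreads_one {Γ : SimpleGraph W} (φ : G ↪g Γ) (f : W → W) {A B : Set W}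
    (h : ∀ y ∈ B, y ∈ Set.range φ → y ∉ A → ∃ x ∈ A, x ∈ Set.range φ ∧ f x = y ∧ Γ.Adj x y) :
    G.Spreads 1 (φ ⁻¹' A) (φ ⁻¹' B) := by
  -- The caller map is a partial section of `f`, hence injective; calls of `f` to vertices outside
  -- the embedded graph are simply omitted.
  have hc : ∀ w, ∃ x, φ w ∈ B → φ w ∉ A → φ x ∈ A ∧ f (φ x) = φ w ∧ Γ.Adj (φ x) (φ w) := by
    intro w
    by_cases hw : φ w ∈ B ∧ φ w ∉ A
    · obtain ⟨_, h₁, ⟨x, rfl⟩, h₂⟩ := h _ hw.1 ⟨w, rfl⟩ hw.2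
      exact ⟨x, fun _ _ => ⟨h₁, h₂⟩⟩
    · exact ⟨w, fun h₁ h₂ => absurd ⟨h₁, h₂⟩ hw⟩
  choose c hc using hc
  have hmem : ∀ w ∈ (φ ⁻¹' A ∪ φ ⁻¹' B) \ φ ⁻¹' A, φ w ∈ B ∧ φ w ∉ A := fun w hw =>
    ⟨hw.1.resolve_left hw.2, hw.2⟩
  refine ⟨φ ⁻¹' A ∪ φ ⁻¹' B, ⟨Set.subset_union_left, c, fun w hw w' hw' he => ?_, fun w hw => ?_⟩,
    Set.subset_union_right⟩
  · obtain ⟨-, h₁, -⟩ := hc w (hmem w hw).1 (hmem w hw).2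
    obtain ⟨-, h₂, -⟩ := hc w' (hmem w' hw').1 (hmem w' hw').2
    rw [he] at h₁
    exact φ.injective (h₁.symm.trans h₂)
  · obtain ⟨h₁, -, h₂⟩ := hc w (hmem w hw).1 (hmem w hw).2
    exact ⟨h₁, φ.map_adj_iff.1 h₂⟩

/-! ### The lower bound on the broadcast time by counting. -/

theorem BroadcastStep.ncard_le [Finite V] {A B : Set V} (h : G.BroadcastStep A B) :
    B.ncard ≤ 2 * A.ncard := by
  obtain ⟨hAB, c, hc, hc'⟩ := h
  have h₁ : (B \ A).ncard ≤ A.ncard :=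
    Set.ncard_le_ncard_of_injOn c (fun w hw => (hc' w hw).1) hc
  have := Set.ncard_sdiff_add_ncard_of_subset hAB
  omega

theorem BroadcastsWithin.card_le [Finite V] {v : V} {T : ℕ} (h : G.BroadcastsWithin v T) :
    Nat.card V ≤ 2 ^ T := by
  obtain ⟨I, h₀, h₁, h₂⟩ := h
  have key : ∀ i ≤ T, (I i).ncard ≤ 2 ^ i := by
    intro i
    induction i with
    | zero => simp [h₀]
    | succ i ih =>
      intro hi
      have := (h₁ i (by omega)).ncard_le
      have := ih (by omega)
      rw [pow_succ]
      omega
  have := key T le_rfl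
  rwa [h₂, Set.ncard_univ] at this

theorem broadcastTime_eq [Finite V] [Nonempty V] {k : ℕ} (hk : Nat.clog 2 (Nat.card V) = k)
    (h : ∀ v, G.BroadcastsWithin v k) : G.broadcastTime = k ∧ G.IsBroadcastGraph := by
  have hv : ∀ v, G.vertexBroadcastTime v = k := by
    intro v
    refine le_antisymm (iInf₂_le k (h v)) (le_iInf₂ fun T hT => ?_)
    rw [Nat.cast_le, ← hk]
    exact Nat.clog_le_of_le_pow hT.card_le
  have hG : G.broadcastTime = k := by
    unfold broadcastTime
    simp [hv]
  exact ⟨hG, by rw [IsBroadcastGraph, hG, hk]⟩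

end SimpleGraph

namespace Binomial

/-! ### The union of two infinite Accelerated-Binomial graphs -/

/-- The edges of `double`: the vertex `none` is joined to all integers, and the nonnegative and
the nonpositive integers each carry a copy of the infinite binomial tree with its shortcuts. -/
inductive DoubleEdge : Option ℤ → Option ℤ → Prop
  | apex (z : ℤ) : DoubleEdge none (some z)
  | right (p v : ℕ) : Joined p v → DoubleEdge (some (p : ℤ)) (some (v : ℤ))
  | left (p v : ℕ) : Joined p v → DoubleEdge (some (-(p : ℤ))) (some (-(v : ℤ)))

/-- The parallel composition of two infinite Accelerated-Binomial graphs. -/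
def double : SimpleGraph (Option ℤ) := SimpleGraph.fromRel DoubleEdge

theorem double_adj_none (z : ℤ) : double.Adj none (some z) := ⟨by simp, .inl (.apex z)⟩

theorem double_adj_right {u v : ℕ} :
    double.Adj (some (u : ℤ)) (some (v : ℤ)) ↔ Joined u v ∨ Joined v u := by
  have key : ∀ {u v : ℕ}, DoubleEdge (some (u : ℤ)) (some (v : ℤ)) → Joined u v := by
    intro u v h
    generalize hx : (u : ℤ) = x at h
    generalize hy : (v : ℤ) = y at h
    cases h with
    | right p q h => rwa [Int.ofNat_inj.1 hx, Int.ofNat_inj.1 hy]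
    | left p q h => have := h.lt; omega
  constructor
  · rintro ⟨-, h | h⟩
    · exact .inl (key h)
    · exact .inr (key h)
  · rintro (h | h)
    · exact ⟨by have := h.lt; simp; omega, .inl (.right _ _ h)⟩
    · exact ⟨by have := h.lt; simp; omega, .inr (.right _ _ h)⟩

theorem double_adj_left {u v : ℕ} :
    double.Adj (some (-(u : ℤ))) (some (-(v : ℤ))) ↔ Joined u v ∨ Joined v u := by
  have key : ∀ {u v : ℕ}, DoubleEdge (some (-(u : ℤ))) (some (-(v : ℤ))) → Joined u v := by
    intro u v h
    generalize hx : -(u : ℤ) = x at h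
    generalize hy : -(v : ℤ) = y at h
    cases h with
    | right p q h => have := h.lt; omega
    | left p q h => rwa [show u = p by omega, show v = q by omega]
  constructor
  · rintro ⟨-, h | h⟩
    · exact .inl (key h)
    · exact .inr (key h)
  · rintro (h | h)
    · exact ⟨by have := h.lt; simp; omega, .inl (.left _ _ h)⟩
    · exact ⟨by have := h.lt; simp; omega, .inr (.left _ _ h)⟩

theorem double_adj_cases {y z : ℤ} (h : double.Adj (some y) (some z)) :
    ∃ u v : ℕ, (Joined u v ∨ Joined v u) ∧ (y = u ∧ z = v ∨ y = -u ∧ z = -v) := by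
  have key : ∀ {y z : ℤ}, DoubleEdge (some y) (some z) →
      ∃ u v : ℕ, Joined u v ∧ (y = u ∧ z = v ∨ y = -u ∧ z = -v) := by
    intro y z h
    cases h with
    | right p q h => exact ⟨p, q, h, .inl ⟨rfl, rfl⟩⟩
    | left p q h => exact ⟨p, q, h, .inr ⟨rfl, rfl⟩⟩
  rcases h.2 with h | h
  · obtain ⟨u, v, h₁, h₂⟩ := key h
    exact ⟨u, v, .inl h₁, h₂⟩
  · obtain ⟨u, v, h₁, h₂⟩ := key h
    exact ⟨v, u, .inr h₁, by tauto⟩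

/-- The position of an integer on the line. -/
noncomputable def intPos (z : ℤ) : ℝ := if 0 ≤ z then pos z.toNat else -pos (-z).toNat

theorem intPos_natCast (u : ℕ) : intPos u = pos u := by simp [intPos]

theorem intPos_neg_natCast (u : ℕ) : intPos (-u) = -pos u := by
  rcases Nat.eq_zero_or_pos u with rfl | h
  · simp [intPos, pos_zero]
  · rw [intPos, if_neg (by omega)]
    simp

theorem intPos_injective : Function.Injective intPos := by
  have key : ∀ u v : ℕ, pos u = -pos v → u = 0 ∧ v = 0 := by
    intro u v h
    have h₁ := (pos_mem u).1
    have h₂ := (pos_mem v).1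
    exact ⟨pos_injective (by rw [pos_zero]; linarith), pos_injective (by rw [pos_zero]; linarith)⟩
  intro y z h
  obtain ⟨u, rfl | rfl⟩ := Int.eq_nat_or_neg y <;> obtain ⟨v, rfl | rfl⟩ := Int.eq_nat_or_neg z <;>
    simp only [intPos_natCast, intPos_neg_natCast] at h
  · rw [pos_injective h]
  · obtain ⟨rfl, rfl⟩ := key _ _ h
    rfl
  · obtain ⟨rfl, rfl⟩ := key _ _ h.symm
    rfl
  · rw [pos_injective (neg_injective h)]

theorem double_adj_posEdge {y z : ℤ} (h : double.Adj (some y) (some z))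
    (hlt : intPos y < intPos z) :
    ∃ u v : ℕ, PosEdge u v ∧ (y = u ∧ z = v ∨ y = -v ∧ z = -u) := by
  obtain ⟨u, v, h₁, h₂⟩ := double_adj_cases h
  have h₃ : PosEdge u v ∨ PosEdge v u := by
    rcases h₁ with h₁ | h₁
    · exact h₁.posEdge
    · exact h₁.posEdge.symm
  rcases h₂ with ⟨rfl, rfl⟩ | ⟨rfl, rfl⟩ <;>
    simp only [intPos_natCast, intPos_neg_natCast] at hlt <;> rcases h₃ with h₃ | h₃
  · exact ⟨u, v, h₃, .inl ⟨rfl, rfl⟩⟩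
  · exact absurd hlt h₃.pos_lt.asymm
  · exact absurd (neg_lt_neg_iff.1 hlt) h₃.pos_lt.asymm
  · exact ⟨v, u, h₃, .inr ⟨rfl, rfl⟩⟩

theorem double_isPlanar : double.IsPlanar := by
  refine SimpleGraph.isPlanar_of_noncrossing _ intPos intPos_injective ?_
  intro a b c d hab hcd hlt hlt'
  obtain ⟨u, v, h₁, ⟨rfl, rfl⟩ | ⟨rfl, rfl⟩⟩ := double_adj_posEdge hab hlt <;>
    obtain ⟨u', v', h₂, ⟨rfl, rfl⟩ | ⟨rfl, rfl⟩⟩ := double_adj_posEdge hcd hlt' <;>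
    simp only [intPos_natCast, intPos_neg_natCast]
  · exact h₁.noncrossing h₂
  · have := (pos_mem u).1
    have := (pos_mem u').1
    right; left; linarith
  · have := (pos_mem u).1
    have := (pos_mem u').1
    left; linarith
  · have := h₁.noncrossing h₂
    unfold Noncrossing at *
    simp only [neg_le_neg_iff]
    tauto

/-! ### The parallel composition as an induced subgraph -/

theorem AB_adj_none {k : ℕ} (v : Fin (2 ^ k)) : (AB k).Adj none (some v) :=
  .inl ⟨by simp, .inr (.apex v)⟩

theorem AB_adj_some {k : ℕ} {u v : Fin (2 ^ k)} :
    (AB k).Adj (some u) (some v) ↔ Joined u v ∨ Joined v u := by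
  constructor
  · rintro (⟨-, h | h⟩ | ⟨-, h | h⟩)
    · cases h with | tree _ _ h => exact .inl (.inl h)
    · cases h with | tree _ _ h => exact .inr (.inl h)
    · cases h with | mk _ _ h => exact .inl (.inr h)
    · cases h with | mk _ _ h => exact .inr (.inr h)
  · intro h
    have hne : some u ≠ some v := by
      rintro he
      obtain rfl := Option.some_injective _ he
      rcases h with h | h <;> exact absurd h.lt (lt_irrefl _)
    rcases h with (h | h) | (h | h)
    · exact .inl ⟨hne, .inl (.tree _ _ h)⟩
    · exact .inr ⟨hne, .inl (.mk _ _ h)⟩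
    · exact .inl ⟨hne, .inr (.tree _ _ h)⟩
    · exact .inr ⟨hne, .inr (.mk _ _ h)⟩

/-- `AB k` as a subgraph of the right half of `double`. -/
def toRight {k : ℕ} (x : Vert k) : Option ℤ := x.map fun u : Fin (2 ^ k) => ((u : ℕ) : ℤ)

/-- `AB k` as a subgraph of the left half of `double`. -/
def toLeft {k : ℕ} (x : Vert k) : Option ℤ := x.map fun u : Fin (2 ^ k) => -((u : ℕ) : ℤ)

theorem AB_adj_iff_toRight {k : ℕ} (x y : Vert k) :
    (AB k).Adj x y ↔ double.Adj (toRight x) (toRight y) := by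
  rcases x with _ | u <;> rcases y with _ | v
  · simp [toRight]
  · exact iff_of_true (AB_adj_none v) (double_adj_none _)
  · exact iff_of_true (AB_adj_none u).symm (double_adj_none _).symm
  · exact AB_adj_some.trans double_adj_right.symm

theorem AB_adj_iff_toLeft {k : ℕ} (x y : Vert k) :
    (AB k).Adj x y ↔ double.Adj (toLeft x) (toLeft y) := by
  rcases x with _ | u <;> rcases y with _ | v
  · simp [toLeft]
  · exact iff_of_true (AB_adj_none v) (double_adj_none _)
  · exact iff_of_true (AB_adj_none u).symm (double_adj_none _).symm
  · exact AB_adj_some.trans double_adj_left.symm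

section Parallel

variable {a b : ℕ}

/-- The coding of the vertices of `parallelAB a b` as vertices of `double`. -/
def toDouble : Parallel.Vert (Vert a) (s b) (t b) → Option ℤ :=
  Sum.elim toRight fun x => toLeft x.1

/-- The inclusion of the second factor into `parallelAB a b`. -/
noncomputable abbrev glueAB : Vert b → Parallel.Vert (Vert a) (s b) (t b) :=
  Parallel.glue (s a) (t a) (s b) (t b)

theorem glueAB_inr (x : {v : Vert b // v ≠ s b ∧ v ≠ t b}) :
    glueAB (a := a) x.1 = Sum.inr x := by
  simp [glueAB, Parallel.glue, x.2.1, x.2.2]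

theorem toDouble_glueAB (x : Vert b) : toDouble (glueAB (a := a) x) = toLeft x := by
  unfold glueAB Parallel.glue
  split_ifs with h₁ h₂
  · subst h₁; simp [toDouble, toRight, toLeft, s]
  · subst h₂; rfl
  · rfl

theorem toDouble_injective : Function.Injective (toDouble (a := a) (b := b)) := by
  have key : ∀ (x : Vert a) (y : {v : Vert b // v ≠ s b ∧ v ≠ t b}), toRight x ≠ toLeft y.1 := by
    rintro (_ | u) ⟨_ | v, h₁, h₂⟩ he
    · exact h₂ rfl
    · simp [toRight, toLeft] at he
    · simp [toRight, toLeft] at he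
    · have he : (u : ℤ) = -(v : ℤ) := Option.some_injective _ he
      exact h₁ (congrArg some (Fin.ext (show (v : ℕ) = 0 by omega)))
  have hr : Function.Injective (toRight (k := a)) :=
    Option.map_injective fun u v (h : ((u : ℕ) : ℤ) = (v : ℕ)) => Fin.ext (by omega)
  have hl : Function.Injective (toLeft (k := b)) :=
    Option.map_injective fun u v (h : -((u : ℕ) : ℤ) = -(v : ℕ)) => Fin.ext (by omega)
  exact hr.sumElim (hl.comp Subtype.val_injective) key

theorem parallelAB_adj_iff (x y : Parallel.Vert (Vert a) (s b) (t b)) :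
    (parallelAB a b).Adj x y ↔ double.Adj (toDouble x) (toDouble y) := by
  -- A neighbour of a negative integer that lies in the first factor must be a terminal, so such an
  -- edge comes from the second factor.
  have mixed : ∀ (x : Vert a) (y : {v : Vert b // v ≠ s b ∧ v ≠ t b}),
      double.Adj (toRight x) (toLeft y.1) → (parallelAB a b).Adj (Sum.inl x) (Sum.inr y) := by
    intro x y h
    obtain ⟨z, hz⟩ : ∃ z, Sum.inl x = glueAB (a := a) (b := b) z := by
      rcases x with _ | u
      · exact ⟨t b, by simp [glueAB, Parallel.glue, t, s]⟩
      · rcases y with ⟨_ | v, h₁, h₂⟩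
        · exact absurd rfl h₂
        · refine ⟨s b, ?_⟩
          have hv : (v : ℕ) ≠ 0 := fun h => h₁ (congrArg some (Fin.ext h))
          obtain ⟨p, q, -, h₃⟩ := double_adj_cases h
          have : (u : ℕ) = 0 := by
            dsimp only at h₃
            omega
          simp only [glueAB, Parallel.glue, dif_pos]
          exact congrArg (Sum.inl ∘ some) (Fin.ext this)
    have hz' : toRight x = toLeft z := (congrArg toDouble hz).trans (toDouble_glueAB z)
    rw [hz'] at h
    refine .inr ⟨by simp, z, y.1, (AB_adj_iff_toLeft _ _).2 h, hz.symm, glueAB_inr y⟩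
  constructor
  · rintro (⟨-, u, v, h, rfl, rfl⟩ | ⟨-, u, v, h, rfl, rfl⟩)
    · exact (AB_adj_iff_toRight _ _).1 h
    · change double.Adj (toDouble (glueAB u)) (toDouble (glueAB v))
      rw [toDouble_glueAB, toDouble_glueAB]
      exact (AB_adj_iff_toLeft _ _).1 h
  · intro h
    have hne : x ≠ y := fun he => h.ne (congrArg _ he)
    rcases x with x | x <;> rcases y with y | y
    · exact .inl ⟨hne, x, y, (AB_adj_iff_toRight _ _).2 h, rfl, rfl⟩
    · exact mixed x y h
    · exact (mixed y x h.symm).symm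
    · exact .inr ⟨hne, x.1, y.1, (AB_adj_iff_toLeft _ _).2 h, glueAB_inr x, glueAB_inr y⟩

/-- `parallelAB a b` as an induced subgraph of `double`. -/
noncomputable def parallelABEmbedding (a b : ℕ) : parallelAB a b ↪g double where
  toFun := toDouble
  inj' := toDouble_injective
  map_rel_iff' := (parallelAB_adj_iff _ _).symm

end Parallel

/-- The vertex `none` and the integers strictly between `-q` and `p`. -/
def region (p q : ℤ) : Set (Option ℤ) := {o | ∀ z ∈ o, -q < z ∧ z < p}

theorem none_mem_region (p q : ℤ) : none ∈ region p q := by simp [region]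

theorem some_mem_region {p q z : ℤ} : some z ∈ region p q ↔ -q < z ∧ z < p := by simp [region]

theorem range_parallelABEmbedding (a b : ℕ) :
    Set.range (parallelABEmbedding a b) = region (2 ^ a) (2 ^ b) := by
  ext o
  constructor
  · rintro ⟨(_ | u) | ⟨_ | v, h₁, h₂⟩, rfl⟩
    · exact none_mem_region _ _
    · have h : ((u : ℕ) : ℤ) < 2 ^ a := by exact_mod_cast u.2
      have : (0 : ℤ) < 2 ^ b := by positivity
      exact some_mem_region.2 ⟨by dsimp only; omega, h⟩
    · exact absurd rfl h₂
    · have h : ((v : ℕ) : ℤ) < 2 ^ b := by exact_mod_cast v.2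
      have : (0 : ℤ) < 2 ^ a := by positivity
      exact some_mem_region.2 ⟨by dsimp only; omega, by dsimp only; omega⟩
  · intro ho
    rcases o with _ | z
    · exact ⟨Sum.inl none, rfl⟩
    · obtain ⟨h₁, h₂⟩ := some_mem_region.1 ho
      rcases le_or_gt 0 z with hz | hz
      · lift z to ℕ using hz
        exact ⟨Sum.inl (some ⟨z, by exact_mod_cast h₂⟩), rfl⟩
      · obtain ⟨n, rfl⟩ : ∃ n : ℕ, z = -n := ⟨z.natAbs, by omega⟩
        refine ⟨Sum.inr ⟨some ⟨n, by zify; omega⟩, ?_, by simp [t]⟩, rfl⟩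
        simp only [s, ne_eq, Option.some.injEq, Fin.mk.injEq]
        omega

theorem card_region (p q : ℕ) (hq : 1 ≤ q) : Nat.card (region p q) = p + q := by
  have h : region p q = insert none (some '' Set.Ioo (-(q : ℤ)) p) := by
    ext (_ | z)
    · simp [none_mem_region]
    · simp [some_mem_region]
  rw [h, Nat.card_coe_set_eq, Set.ncard_insert_of_notMem (by simp),
    Set.ncard_image_of_injective _ (Option.some_injective _), Set.ncard_eq_toFinset_card']
  simp
  omega

end Binomial

namespace Binomial

open SimpleGraph

/-! ### Broadcasting in the parallel composition -/

theorem double_adj_add {x : ℤ} {j : ℕ} (h₀ : 0 ≤ x) (h : x < 2 ^ j) :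
    double.Adj (some x) (some (x + 2 ^ j)) := by
  lift x to ℕ using h₀
  have := double_adj_right.2 (.inl (.inl (isParent_add_two_pow (by exact_mod_cast h : x < 2 ^ j))))
  push_cast at this
  exact this

theorem double_adj_sub {x : ℤ} {j : ℕ} (h₀ : x ≤ 0) (h : -2 ^ j < x) :
    double.Adj (some x) (some (x - 2 ^ j)) := by
  obtain ⟨n, rfl⟩ : ∃ n : ℕ, x = -n := ⟨x.natAbs, by omega⟩
  have hn : n < 2 ^ j := by zify; omega
  have := double_adj_left.2 (.inl (.inl (isParent_add_two_pow hn)))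
  push_cast at this
  rwa [neg_add, ← sub_eq_add_neg] at this

theorem joined_shortcut {v : ℕ} (h : v ≠ 0) : Joined (shortcut v) v := .inr (isShortcut_shortcut h)

/-- The path from `v` to the root along shortcuts. -/
def chain (v j : ℕ) : ℕ := shortcut^[j] v

theorem chain_succ (v j : ℕ) : chain v (j + 1) = shortcut (chain v j) :=
  Function.iterate_succ_apply' _ _ _

theorem chain_le (v j : ℕ) : chain v j ≤ v := by
  induction j with
  | zero => exact le_rfl
  | succ j ih => exact chain_succ v j ▸ (shortcut_le _).trans ih

theorem label_chain_le (v j : ℕ) : label (chain v j) ≤ label v - j := by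
  induction j with
  | zero => exact le_rfl
  | succ j ih =>
    have := label_shortcut_le (chain v j)
    rw [chain_succ]
    omega

theorem step_le_label (v : ℕ) : step v ≤ 3 * label v := by
  rw [label]
  omega

variable {V : Type*} {G : SimpleGraph V} (φ : G ↪g double) {K N : ℤ}

/-- A positive `x` calls `x + 2 ^ i` and a nonpositive `x` calls `x - 2 ^ j`. As `0` is used up by
the left half, `t` calls `2 ^ i` in its place. Each caller lies between `0` and its callee, so it is
present whenever the callee is. -/
theorem spreads_region_step (hφ : Set.range φ = region K N)
    (hK₀ : 0 < K) (hN₀ : 0 < N) (i j : ℕ) : G.Spreads 1 (φ ⁻¹' region (2 ^ i) (2 ^ j))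
    (φ ⁻¹' region (2 ^ (i + 1)) (2 ^ (j + 1))) := by
  refine spreads_one φ (fun o => o.elim (some (2 ^ i)) fun x =>
    if 0 < x then some (x + 2 ^ i) else some (x - 2 ^ j)) ?_
  rw [hφ]
  have hi : (0 : ℤ) < 2 ^ i := by positivity
  have hj : (0 : ℤ) < 2 ^ j := by positivity
  rintro (_ | z) hB hR hA
  · exact absurd (none_mem_region _ _) hA
  · rw [some_mem_region] at hB hR hA
    rw [pow_succ, pow_succ] at hB
    rcases lt_trichotomy z (2 ^ i) with h | rfl | h
    · have hz : z + 2 ^ j ≤ 0 := by omega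
      refine ⟨some (z + 2 ^ j), some_mem_region.2 (by omega), some_mem_region.2 (by omega), ?_, ?_⟩
      · simp [hz]
      · simpa using double_adj_sub (j := j) hz (by omega)
    · exact ⟨none, none_mem_region _ _, none_mem_region _ _, rfl, double_adj_none _⟩
    · have hz : 0 < z - 2 ^ i := by omega
      refine ⟨some (z - 2 ^ i), some_mem_region.2 (by omega), some_mem_region.2 (by omega), ?_, ?_⟩
      · simp only [Option.elim_some, if_pos hz, sub_add_cancel]
      · simpa using double_adj_add (j := i) hz.le (by omega)

theorem spreads_univ_of_region (hφ : Set.range φ = region K N)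
    (hK₀ : 0 < K) (hN₀ : 0 < N) {i j n : ℕ} (hK : K ≤ 2 ^ (i + n)) (hN : N ≤ 2 ^ (j + n)) :
    G.Spreads n (φ ⁻¹' region (2 ^ i) (2 ^ j)) Set.univ := by
  induction n generalizing i j with
  | zero =>
    intro v _
    have hv : φ v ∈ region K N := hφ ▸ Set.mem_range_self v
    rw [Set.mem_preimage]
    cases h : φ v with
    | none => exact none_mem_region _ _
    | some z =>
      rw [h, some_mem_region] at hv
      rw [add_zero] at hK hN
      exact some_mem_region.2 (by omega)
  | succ n ih =>
    rw [add_comm n 1]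
    refine (spreads_region_step φ hφ hK₀ hN₀ i j).trans (ih ?_ ?_)
    · rwa [add_assoc, add_comm 1 n]
    · rwa [add_assoc, add_comm 1 n]

/-- The set of informed vertices after `σ + 1` time units in the scheme for an originator in the
right half: the first vertices of the chain `w`, and the root's subtree of depth `σ` without its
vertex nearest to `w i`. -/
def climbing (w : ℕ → ℕ) (i σ : ℕ) : Set (Option ℤ) :=
  {o | o = none ∨ (∃ j ≤ σ, o = some (w j : ℤ)) ∨
    ∃ x : ℕ, x < 2 ^ σ ∧ x ≠ w i % 2 ^ σ ∧ o = some (x : ℤ)}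

/-- A hole at `h = w i % 2 ^ σ` would leave both `h` and `h + 2 ^ σ` uninformed; `t` calls one of
them and the other, `w i % 2 ^ (σ + 1)`, is the new hole. So the hole always heads for `w i`, which
the chain will reach. By `hs`, the chain vertex `w σ` has no duty in the tree and is free to call `w
(σ + 1)`. -/
theorem spreads_climbing (hφ : Set.range φ = region K N)
    (hN : 0 < N) {w : ℕ → ℕ} {i σ : ℕ} (hw : Joined (w (σ + 1)) (w σ))
    (hwK : w σ < K) (hs : 2 ^ σ ≤ w σ) :
    G.Spreads 1 (φ ⁻¹' climbing w i σ) (φ ⁻¹' climbing w i (σ + 1)) := by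
  refine spreads_one φ (fun o => o.elim
    (some ((if w i % 2 ^ (σ + 1) = w i % 2 ^ σ then w i % 2 ^ σ + 2 ^ σ else w i % 2 ^ σ : ℕ) : ℤ))
    fun x => if x < 2 ^ σ then some (x + 2 ^ σ) else some (w (σ + 1) : ℤ)) ?_
  rw [hφ]
  have hmod : w i % 2 ^ (σ + 1) = w i % 2 ^ σ ∨ w i % 2 ^ (σ + 1) = w i % 2 ^ σ + 2 ^ σ := by
    rw [Nat.mod_pow_succ]
    rcases Nat.mod_two_eq_zero_or_one (w i / 2 ^ σ) with h | h <;> rw [h] <;> simp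
  have hlt : w i % 2 ^ σ < 2 ^ σ := Nat.mod_lt _ (Nat.two_pow_pos σ)
  have hnone : none ∈ climbing w i σ := .inl rfl
  rintro y (rfl | ⟨j, hj, rfl⟩ | ⟨x, hx, hne, rfl⟩) hR hA
  · exact absurd hnone hA
  · obtain rfl : j = σ + 1 := by
      by_contra hjσ
      exact hA (.inr (.inl ⟨j, by omega, rfl⟩))
    rw [some_mem_region] at hR
    refine ⟨some (w σ : ℤ), .inr (.inl ⟨σ, le_rfl, rfl⟩), some_mem_region.2 (by omega), ?_, ?_⟩
    · have : ¬ ((w σ : ℤ) < 2 ^ σ) := by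
        rw [not_lt]; exact_mod_cast hs
      simp only [Option.elim_some, if_neg this]
    · exact double_adj_right.2 (.inr hw)
  · rw [some_mem_region] at hR
    rw [pow_succ] at hx
    rcases Nat.lt_or_ge x (2 ^ σ) with h | h
    · have hxh : x = w i % 2 ^ σ := by
        by_contra hne'
        exact hA (.inr (.inr ⟨x, h, hne', rfl⟩))
      refine ⟨none, hnone, none_mem_region _ _, ?_, double_adj_none _⟩
      rw [Option.elim_none, if_neg (by omega), hxh]
    · by_cases hxh : x - 2 ^ σ = w i % 2 ^ σ
      · refine ⟨none, hnone, none_mem_region _ _, ?_, double_adj_none _⟩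
        rw [Option.elim_none, if_pos (by omega), ← hxh, Nat.sub_add_cancel h]
      · obtain ⟨x, rfl⟩ := Nat.exists_eq_add_of_le' h
        rw [Nat.add_sub_cancel] at hxh
        have hx' : x < 2 ^ σ := by omega
        have hx'' : (x : ℤ) < 2 ^ σ := by exact_mod_cast hx'
        push_cast at hR ⊢
        have : (0 : ℤ) < 2 ^ σ := by positivity
        refine ⟨some (x : ℤ), .inr (.inr ⟨x, hx', hxh, rfl⟩), some_mem_region.2 (by omega), ?_, ?_⟩
        · simp only [Option.elim_some, if_pos hx'']
        · exact double_adj_add (by omega) hx''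

/-- Here the hole is `w i` itself, which the chain has just informed. -/
theorem region_subset_climbing {w : ℕ → ℕ} {i : ℕ} (h : w i < 2 ^ i) :
    region (2 ^ i) (2 ^ 0) ⊆ climbing w i i := by
  rintro (_ | z) hz
  · exact .inl rfl
  · obtain ⟨h₁, h₂⟩ := some_mem_region.1 hz
    lift z to ℕ using by omega
    by_cases he : z = w i
    · exact .inr (.inl ⟨i, le_rfl, by rw [he]⟩)
    · exact .inr (.inr ⟨z, by exact_mod_cast h₂, by rwa [Nat.mod_eq_of_lt h], rfl⟩)

/-- Now `w i = h + 2 ^ i`, where the hole `h` is its parent, so `w i` and `h` exchange roles: `w i`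
calls `h`, whose own callee is already informed. The left half gets its first vertex `-1` from `0`,
or from `t` when `0` is the hole. -/
theorem spreads_climbing_region (hφ : Set.range φ = region K N)
    {w : ℕ → ℕ} {i : ℕ} (h₁ : 2 ^ i ≤ w i) (h₂ : w i < 2 ^ (i + 1))
    (hK : w i < K) (hN : 0 < N) :
    G.Spreads 1 (φ ⁻¹' climbing w i i) (φ ⁻¹' region (2 ^ (i + 1)) (2 ^ 1)) := by
  obtain ⟨h, hh⟩ := Nat.exists_eq_add_of_le' h₁
  rw [pow_succ] at h₂
  have hlt : h < 2 ^ i := by omega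
  have hmod : w i % 2 ^ i = h := by rw [hh, Nat.add_mod_right, Nat.mod_eq_of_lt hlt]
  have hpos : 0 < 2 ^ i := Nat.two_pow_pos i
  refine spreads_one φ (fun o => o.elim (if h = 0 then some (-1) else some (2 ^ i)) fun x =>
    if x = w i then some (h : ℤ) else if 0 < x then some (x + 2 ^ i) else some (x - 1)) ?_
  rw [hφ]
  have hnone : none ∈ climbing w i i := .inl rfl
  have hwmem : some (w i : ℤ) ∈ climbing w i i := .inr (.inl ⟨i, le_rfl, rfl⟩)
  have hmem : ∀ x : ℕ, x < 2 ^ i → x ≠ h → some (x : ℤ) ∈ climbing w i i := fun x hx hxh =>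
    .inr (.inr ⟨x, hx, by rwa [hmod], rfl⟩)
  rintro (_ | z) hB hR hA
  · exact absurd hnone hA
  · rw [some_mem_region] at hB hR
    have hz : -1 ≤ z := by omega
    rcases hz.lt_or_eq with hz | rfl
    · lift z to ℕ using by omega
      have hz' : z < 2 ^ (i + 1) := by exact_mod_cast hB.2
      rw [pow_succ] at hz'
      rcases Nat.lt_or_ge z (2 ^ i) with hzi | hzi
      · obtain rfl : z = h := by
          by_contra hne
          exact hA (hmem z hzi hne)
        refine ⟨some (w i : ℤ), hwmem, some_mem_region.2 (by omega), by simp, ?_⟩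
        rw [hh]
        exact double_adj_right.2 (.inr (.inl (isParent_add_two_pow hlt)))
      · obtain ⟨x, rfl⟩ := Nat.exists_eq_add_of_le' hzi
        have hxh : x ≠ h := by
          rintro rfl
          exact hA (hh ▸ hwmem)
        rcases Nat.eq_zero_or_pos x with rfl | hx0
        · refine ⟨none, hnone, none_mem_region _ _, ?_, double_adj_none _⟩
          rw [Option.elim_none, if_neg hxh.symm]
          simp
        · have hx : x < 2 ^ i := by omega
          have hxw : (x : ℤ) ≠ w i := by omega
          refine ⟨some (x : ℤ), hmem x hx hxh, some_mem_region.2 (by omega), ?_,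
            double_adj_right.2 (.inl (.inl (isParent_add_two_pow hx)))⟩
          rw [Option.elim_some, if_neg hxw, if_pos (by omega)]
          simp
    · by_cases h0 : h = 0
      · refine ⟨none, hnone, none_mem_region _ _, ?_, double_adj_none _⟩
        rw [Option.elim_none, if_pos h0]
      · refine ⟨some ((0 : ℕ) : ℤ), hmem 0 hpos (Ne.symm h0), some_mem_region.2 (by omega), ?_, ?_⟩
        · rw [Option.elim_some, if_neg (by omega), if_neg (by simp)]
          rfl
        · exact double_adj_sub (j := 0) (by simp) (by simp)

/-- The climb stops at the first `i` with `chain u i < 2 ^ (i + 1)`, where the chain meets the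
growing tree. At that point the hole is either filled or is filled in one further unit that also
counts as a doubling. -/
theorem spreads_from_right (hφ : Set.range φ = region K N)
    {k u : ℕ} {v : V} (hk : 2 ≤ k) (hK : K = 2 ^ (k - 1)) (hN : 0 < N)
    (hN' : N ≤ 2 ^ (3 * k / 4 - 1)) (hv : φ v = some (u : ℤ)) : G.Spreads k {v} Set.univ := by
  have huK : u < 2 ^ (k - 1) := by
    have h : φ v ∈ region K N := hφ ▸ Set.mem_range_self v
    rw [hv, hK, some_mem_region] at h
    exact_mod_cast h.2
  -- Each shortcut lowers the bound on the number of binary digits by three while the tree gains one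
  -- level, so they meet once `4 * i ≥ k`. Then `k - 1 - i ≥ 3 * k / 4 - 1` doublings remain for the
  -- left half.
  have hM : step (chain u ((k + 3) / 4)) ≤ (k + 3) / 4 + 1 := by
    have h₁ := step_le_label (chain u ((k + 3) / 4))
    have h₂ := label_chain_le u ((k + 3) / 4)
    have h₃ : step u ≤ k - 1 := step_le_iff.2 huK
    rw [label.eq_def u] at h₂
    omega
  classical
  have hex : ∃ i, step (chain u i) ≤ i + 1 := ⟨_, hM⟩
  obtain ⟨i, hi⟩ : ∃ i, i = Nat.find hex := ⟨_, rfl⟩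
  have hiM : i ≤ (k + 3) / 4 := hi ▸ Nat.find_min' hex hM
  have hspec : chain u i < 2 ^ (i + 1) := step_le_iff.1 (hi ▸ Nat.find_spec hex)
  have hmin : ∀ j < i, 2 ^ (j + 1) ≤ chain u j := fun j hj =>
    not_lt.1 fun h => Nat.find_min hex (hi ▸ hj) (step_le_iff.2 h)
  have hwK : ∀ j, (chain u j : ℤ) < K := by
    intro j
    rw [hK]
    exact_mod_cast (chain_le u j).trans_lt huK
  have hstart : G.Spreads 1 {v} (φ ⁻¹' climbing (chain u) i 0) := by
    refine Spreads.mono (spreads_one φ (A := {some (u : ℤ)}) (fun _ => none) ?_) ?_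
    · rintro y (rfl | ⟨j, hj, rfl⟩ | ⟨x, hx, hne, rfl⟩) - hA
      · exact ⟨_, rfl, ⟨v, hv⟩, rfl, (double_adj_none _).symm⟩
      · obtain rfl : j = 0 := by omega
        exact absurd rfl hA
      · rw [pow_zero] at hx hne
        omega
    · intro x hx
      exact φ.injective (Eq.trans hx hv.symm)
  have hclimb : G.Spreads i (φ ⁻¹' climbing (chain u) i 0) (φ ⁻¹' climbing (chain u) i i) := by
    refine Spreads.iterate (F := fun σ => φ ⁻¹' climbing (chain u) i σ) (Nat.zero_le i)
      fun σ _ hσ => spreads_climbing φ hφ hN ?_ (hwK σ) ?_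
    · rw [chain_succ]
      have := hmin σ hσ
      have := Nat.two_pow_pos (σ + 1)
      exact joined_shortcut (by omega)
    · exact (Nat.pow_le_pow_right two_pos (Nat.le_succ σ)).trans (hmin σ hσ)
  have hpow : ∀ {m n : ℕ}, m ≤ n → (2 : ℤ) ^ m ≤ 2 ^ n := fun h =>
    pow_le_pow_right₀ (by norm_num) h
  rcases Nat.lt_or_ge (chain u i) (2 ^ i) with h | h
  · have := (hstart.trans hclimb).trans ((spreads_univ_of_region φ hφ (hK ▸ by positivity) hN (n := k - 1 - i)
      (i := i) (j := 0) (hK.le.trans (hpow (by omega))) (hN'.trans (hpow (by omega)))).mono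
        (Set.preimage_mono (region_subset_climbing h)))
    rwa [show 1 + i + (k - 1 - i) = k by omega] at this
  · have hik : i < k - 1 := by
      have : 2 ^ i < 2 ^ (k - 1) := h.trans_lt ((chain_le u i).trans_lt huK)
      exact (Nat.pow_lt_pow_iff_right (by norm_num)).1 this
    have := ((hstart.trans hclimb).trans
      (spreads_climbing_region φ hφ h hspec (hwK i) hN)).trans
        (spreads_univ_of_region φ hφ (hK ▸ by positivity) hN (n := k - 2 - i)
          (hK.le.trans (hpow (by omega))) (hN'.trans (hpow (by omega))))
    rwa [show 1 + i + 1 + (k - 2 - i) = k by omega] at this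

/-- The set of informed vertices after `σ + 1` time units in the scheme for an originator in the
left half. -/
def approaching (w : ℕ → ℕ) (σ : ℕ) : Set (Option ℤ) :=
  {o | o = none ∨ (∃ j ≤ σ, o = some (-(w j : ℤ))) ∨
    ∃ x : ℕ, 0 < x ∧ x < 2 ^ σ ∧ o = some (x : ℤ)}

/-- The chain runs on the left, so it never interferes with the right tree, which grows without its
root: `t` makes the root's calls. -/
theorem spreads_approaching (hφ : Set.range φ = region K N)
    {w : ℕ → ℕ} {σ : ℕ} (hw : Joined (w (σ + 1)) (w σ)) (hwN : w σ < N) :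
    G.Spreads 1 (φ ⁻¹' approaching w σ) (φ ⁻¹' approaching w (σ + 1)) := by
  refine spreads_one φ (fun o => o.elim (some (2 ^ σ))
    fun x => if 0 < x then some (x + 2 ^ σ) else some (-(w (σ + 1) : ℤ))) ?_
  rw [hφ]
  have hnone : none ∈ approaching w σ := .inl rfl
  rintro y (rfl | ⟨j, hj, rfl⟩ | ⟨x, hx₀, hx, rfl⟩) hR hA
  · exact absurd hnone hA
  · obtain rfl : j = σ + 1 := by
      by_contra hjσ
      exact hA (.inr (.inl ⟨j, by omega, rfl⟩))
    rw [some_mem_region] at hR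
    have := hw.lt
    refine ⟨some (-(w σ : ℤ)), .inr (.inl ⟨σ, le_rfl, rfl⟩), some_mem_region.2 (by omega), ?_,
      double_adj_left.2 (.inr hw)⟩
    rw [Option.elim_some, if_neg (by omega)]
  · rw [some_mem_region] at hR
    rw [pow_succ] at hx
    have h : 2 ^ σ ≤ x := not_lt.1 fun h => hA (.inr (.inr ⟨x, hx₀, h, rfl⟩))
    obtain ⟨x, rfl⟩ := Nat.exists_eq_add_of_le' h
    rcases Nat.eq_zero_or_pos x with rfl | hx0
    · exact ⟨none, hnone, none_mem_region _ _, by simp, double_adj_none _⟩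
    · have hx' : x < 2 ^ σ := by omega
      refine ⟨some (x : ℤ), .inr (.inr ⟨x, hx0, hx', rfl⟩), some_mem_region.2 (by omega), ?_,
        double_adj_right.2 (.inl (.inl (isParent_add_two_pow hx')))⟩
      rw [Option.elim_some, if_pos (by omega)]
      simp

theorem spreads_from_left (hφ : Set.range φ = region K N)
    {k u : ℕ} {v : V} (hk : 2 ≤ k) (hK : K = 2 ^ (k - 1)) (hN : 0 < N)
    (hN' : N ≤ 2 ^ (3 * k / 4 - 1)) (hv : φ v = some (-(u : ℤ))) : G.Spreads k {v} Set.univ := by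
  have huN : (u : ℤ) < N := by
    have h : φ v ∈ region K N := hφ ▸ Set.mem_range_self v
    rw [hv, some_mem_region] at h
    omega
  -- Vertices of the left half have at most `3 * k / 4 - 1` binary digits, hence label at most
  -- `⌈k/4⌉`, and each shortcut lowers a positive label.
  have hM : chain u ((k + 3) / 4) = 0 := by
    have h₂ := label_chain_le u ((k + 3) / 4)
    have h₃ : step u ≤ 3 * k / 4 - 1 := step_le_iff.2 (by exact_mod_cast huN.trans_le hN')
    rw [label.eq_def u] at h₂
    by_contra h
    have := label_pos h
    omega
  classical
  have hex : ∃ i, chain u i = 0 := ⟨_, hM⟩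
  obtain ⟨i, hi⟩ : ∃ i, i = Nat.find hex := ⟨_, rfl⟩
  have hiM : i ≤ (k + 3) / 4 := hi ▸ Nat.find_min' hex hM
  have hspec : chain u i = 0 := hi ▸ Nat.find_spec hex
  have hmin : ∀ j < i, chain u j ≠ 0 := fun j hj => Nat.find_min hex (hi ▸ hj)
  have hstart : G.Spreads 1 {v} (φ ⁻¹' approaching (chain u) 0) := by
    refine Spreads.mono (spreads_one φ (A := {some (-(u : ℤ))}) (fun _ => none) ?_) ?_
    · rintro y (rfl | ⟨j, hj, rfl⟩ | ⟨x, hx, hx', rfl⟩) - hA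
      · exact ⟨_, rfl, ⟨v, hv⟩, rfl, (double_adj_none _).symm⟩
      · obtain rfl : j = 0 := by omega
        exact absurd rfl hA
      · rw [pow_zero] at hx'
        omega
    · intro x hx
      exact φ.injective (Eq.trans hx hv.symm)
  have hclimb : G.Spreads i (φ ⁻¹' approaching (chain u) 0) (φ ⁻¹' approaching (chain u) i) := by
    refine Spreads.iterate (F := fun σ => φ ⁻¹' approaching (chain u) σ) (Nat.zero_le i)
      fun σ _ hσ => spreads_approaching φ hφ ?_ ?_
    · rw [chain_succ]
      exact joined_shortcut (hmin σ hσ)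
    · have := chain_le u σ
      omega
  have hsub : region (2 ^ i) (2 ^ 0) ⊆ approaching (chain u) i := by
    rintro (_ | z) hz
    · exact .inl rfl
    · obtain ⟨h₁, h₂⟩ := some_mem_region.1 hz
      lift z to ℕ using by omega
      rcases Nat.eq_zero_or_pos z with rfl | h0
      · exact .inr (.inl ⟨i, le_rfl, by simp [hspec]⟩)
      · exact .inr (.inr ⟨z, h0, by exact_mod_cast h₂, rfl⟩)
  have hpow : ∀ {m n : ℕ}, m ≤ n → (2 : ℤ) ^ m ≤ 2 ^ n := fun h =>
    pow_le_pow_right₀ (by norm_num) h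
  have := (hstart.trans hclimb).trans ((spreads_univ_of_region φ hφ (hK ▸ by positivity) hN (n := k - 1 - i)
    (i := i) (j := 0) (hK.le.trans (hpow (by omega))) (hN'.trans (hpow (by omega)))).mono
      (Set.preimage_mono hsub))
  rwa [show 1 + i + (k - 1 - i) = k by omega] at this

theorem spreads_from_apex (hφ : Set.range φ = region K N)
    {k : ℕ} {v : V} (hk : 2 ≤ k) (hK : K = 2 ^ (k - 1)) (hN : 0 < N)
    (hN' : N ≤ 2 ^ (3 * k / 4 - 1)) (hv : φ v = none) : G.Spreads k {v} Set.univ := by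
  have hstart : G.Spreads 1 {v} (φ ⁻¹' region (2 ^ 0) (2 ^ 0)) := by
    refine Spreads.mono (spreads_one φ (A := {none}) (fun _ => some 0) ?_) ?_
    · rintro (_ | z) hz - hA
      · exact absurd rfl hA
      · rw [pow_zero, some_mem_region] at hz
        obtain rfl : z = 0 := by omega
        exact ⟨none, rfl, ⟨v, hv⟩, rfl, double_adj_none _⟩
    · intro x hx
      exact φ.injective (Eq.trans hx hv.symm)
  have hpow : ∀ {m n : ℕ}, m ≤ n → (2 : ℤ) ^ m ≤ 2 ^ n := fun h =>
    pow_le_pow_right₀ (by norm_num) h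
  have := hstart.trans (spreads_univ_of_region φ hφ (hK ▸ by positivity) hN (n := k - 1)
    (hK.le.trans (hpow (by omega))) (hN'.trans (hpow (by omega))))
  rwa [show 1 + (k - 1) = k by omega] at this

theorem broadcastsWithin_of_range (hφ : Set.range φ = region K N)
    {k : ℕ} (hk : 2 ≤ k) (hK : K = 2 ^ (k - 1)) (hN : 0 < N)
    (hN' : N ≤ 2 ^ (3 * k / 4 - 1)) (v : V) : G.BroadcastsWithin v k := by
  apply Spreads.broadcastsWithin
  cases hv : φ v with
  | none => exact spreads_from_apex φ hφ hk hK hN hN' hv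
  | some z =>
    obtain ⟨u, rfl | rfl⟩ := Int.eq_nat_or_neg z
    · exact spreads_from_right φ hφ hk hK hN hN' hv
    · exact spreads_from_left φ hφ hk hK hN hN' hv

/-! ### Orders of the graphs and the choice of induced subgraphs. -/

theorem clog_eq {k n : ℕ} (hk : 2 ≤ k) (h₁ : 2 ^ (k - 1) + 1 ≤ n)
    (h₂ : n ≤ 2 ^ (k - 1) + 2 ^ (3 * k / 4 - 1)) : Nat.clog 2 n = k := by
  have h₃ : 2 ^ (3 * k / 4 - 1) ≤ 2 ^ (k - 1) := Nat.pow_le_pow_right two_pos (by omega)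
  have h₄ : 2 ^ k = 2 ^ (k - 1) * 2 := by rw [← pow_succ, Nat.sub_add_cancel (by omega)]
  refine le_antisymm (Nat.clog_le_of_le_pow (by omega)) ?_
  have : k - 1 < Nat.clog 2 n := (Nat.lt_clog_iff_pow_lt (by norm_num)).2 (by omega)
  omega

theorem broadcastTime_eq_of_range {k n : ℕ} (hk : 2 ≤ k) (hn : 0 < n)
    (hn' : n ≤ 2 ^ (3 * k / 4 - 1)) (hφ : Set.range φ = region (2 ^ (k - 1)) n) :
    Nat.card V = 2 ^ (k - 1) + n ∧ G.broadcastTime = k ∧ G.IsBroadcastGraph := by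
  have hcard : Nat.card V = 2 ^ (k - 1) + n := by
    rw [← Nat.card_range_of_injective φ.injective, hφ]
    exact_mod_cast card_region (2 ^ (k - 1)) n hn
  have hpos := Nat.two_pow_pos (k - 1)
  have : Finite V := Nat.finite_of_card_ne_zero (by omega)
  have : Nonempty V := Nat.card_pos_iff.1 (by omega) |>.1
  refine ⟨hcard, broadcastTime_eq (hcard ▸ clog_eq hk (by omega) (by omega)) fun v => ?_⟩
  exact broadcastsWithin_of_range φ hφ hk rfl (by omega) (by exact_mod_cast hn') v

/-- Keeping the whole right half and the left vertices nearest to `0` as numbers leaves exactly a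
region, to which the scheme applies unchanged. -/
theorem exists_subgraph {k n : ℕ} (hk : 2 ≤ k) (h₁ : 2 ^ (k - 1) + 1 ≤ n)
    (h₂ : n ≤ 2 ^ (k - 1) + 2 ^ (3 * k / 4 - 1)) :
    ∃ H : SimpleGraph (Fin n), H.IsPlanar ∧ H.broadcastTime = (k : ℕ∞) ∧ H.IsBroadcastGraph ∧
      ∃ f : H ↪g parallelAB (k - 1) (3 * k / 4 - 1), ∀ v, Sum.inl v ∈ Set.range f := by
  obtain ⟨m, rfl⟩ := Nat.exists_eq_add_of_le (Nat.le_of_succ_le h₁)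
  have hsub : region (2 ^ (k - 1)) m ⊆
      Set.range (parallelABEmbedding (k - 1) (3 * k / 4 - 1)) := by
    rw [range_parallelABEmbedding]
    have : (m : ℤ) ≤ 2 ^ (3 * k / 4 - 1) := by exact_mod_cast (by omega : m ≤ 2 ^ (3 * k / 4 - 1))
    rintro (_ | z) hz
    · exact none_mem_region _ _
    · rw [some_mem_region] at hz ⊢
      omega
  have hcard : Nat.card (region (2 ^ (k - 1)) m) = 2 ^ (k - 1) + m := by
    exact_mod_cast card_region (2 ^ (k - 1)) m (by omega)
  have hpos := Nat.two_pow_pos (k - 1)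
  have : Finite (region (2 ^ (k - 1)) m) := Nat.finite_of_card_ne_zero (by omega)
  obtain ⟨e⟩ : Nonempty (Fin (2 ^ (k - 1) + m) ≃ region (2 ^ (k - 1)) m) :=
    ⟨(Finite.equivFinOfCardEq hcard).symm⟩
  choose g hg using fun i => hsub (e i).2
  have hg_inj : Function.Injective g := fun i j hij =>
    e.injective (Subtype.ext ((hg i).symm.trans ((congrArg _ hij).trans (hg j))))
  let f : (parallelAB (k - 1) (3 * k / 4 - 1)).comap g ↪g parallelAB (k - 1) (3 * k / 4 - 1) :=
    SimpleGraph.Embedding.comap ⟨g, hg_inj⟩ _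
  let φ := f.trans (parallelABEmbedding (k - 1) (3 * k / 4 - 1))
  have hφ : ∀ i, φ i = e i := hg
  have hrange : Set.range φ = region (2 ^ (k - 1)) m := by
    ext o
    constructor
    · rintro ⟨i, rfl⟩
      exact hφ i ▸ (e i).2
    · intro ho
      exact ⟨e.symm ⟨o, ho⟩, by rw [hφ, Equiv.apply_symm_apply]⟩
  obtain ⟨-, h₃, h₄⟩ := broadcastTime_eq_of_range φ hk (by omega) (by omega) hrange
  refine ⟨_, double_isPlanar.of_embedding φ, h₃, h₄, f, fun v => ?_⟩
  have hv : toRight v ∈ Set.range φ := by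
    rw [hrange]
    rcases v with _ | u
    · exact none_mem_region _ _
    · have h : ((u : ℕ) : ℤ) < 2 ^ (k - 1) := by exact_mod_cast u.2
      exact some_mem_region.2 (by dsimp only; omega)
  obtain ⟨i, hi⟩ := hv
  exact ⟨i, (parallelABEmbedding (k - 1) (3 * k / 4 - 1)).injective hi⟩

end Binomial

theorem mainTheorem1 :
    -- For all `k ≥ 2`, the parallel composition itself,
    (∀ k : ℕ, 2 ≤ k →
      Nat.card (Parallel.Vert (Binomial.Vert (k - 1))
          (Binomial.s (3 * k / 4 - 1)) (Binomial.t (3 * k / 4 - 1)))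
        = 2 ^ (k - 1) + 2 ^ (3 * k / 4 - 1) ∧
      (parallelAB (k - 1) (3 * k / 4 - 1)).IsPlanar ∧
      (parallelAB (k - 1) (3 * k / 4 - 1)).broadcastTime = (k : ℕ∞) ∧
      (parallelAB (k - 1) (3 * k / 4 - 1)).IsBroadcastGraph) ∧
    -- and, for all `n` in the range, a graph on `n` vertices which arises from it by deleting
    -- vertices of the second factor other than `s` and `t`.
    (∀ k n : ℕ, 2 ≤ k → 2 ^ (k - 1) + 1 ≤ n → n ≤ 2 ^ (k - 1) + 2 ^ (3 * k / 4 - 1) →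
      Nat.clog 2 n = k ∧
      ∃ H : SimpleGraph (Fin n),
        H.IsPlanar ∧ H.broadcastTime = (k : ℕ∞) ∧ H.IsBroadcastGraph ∧
        ∃ f : H ↪g parallelAB (k - 1) (3 * k / 4 - 1), ∀ v, Sum.inl v ∈ Set.range f) ∧
    -- For all large `k` this beats the bound of Hell and Seyffarth.
    (∀ᶠ k : ℕ in atTop, ∃ n : ℕ, 2 ^ (k - 1) + 2 ^ (2 * k / 3) + 1 < n ∧
      ∃ H : SimpleGraph (Fin n),
        H.IsPlanar ∧ H.broadcastTime = (k : ℕ∞) ∧ H.IsBroadcastGraph) := by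
  refine ⟨fun k hk => ?_, fun k n hk h₁ h₂ => ⟨Binomial.clog_eq hk h₁ h₂,
    Binomial.exists_subgraph hk h₁ h₂⟩, ?_⟩
  · have hrange := Binomial.range_parallelABEmbedding (k - 1) (3 * k / 4 - 1)
    obtain ⟨h₁, h₂, h₃⟩ := Binomial.broadcastTime_eq_of_range
      (Binomial.parallelABEmbedding (k - 1) (3 * k / 4 - 1)) (n := 2 ^ (3 * k / 4 - 1)) hk
      (Nat.two_pow_pos _) le_rfl (by rw [hrange]; push_cast; rfl)
    exact ⟨h₁, Binomial.double_isPlanar.of_embedding (Binomial.parallelABEmbedding _ _), h₂, h₃⟩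
  -- From `36` on, `3 * k / 4 - 1` exceeds `2 * k / 3` despite the rounding, so the second power of
  -- two at least doubles, which absorbs the extra `1`.
  · filter_upwards [eventually_ge_atTop 36] with k hk
    refine ⟨2 ^ (k - 1) + 2 ^ (3 * k / 4 - 1), ?_, ?_⟩
    · have h₁ : 2 ^ (2 * k / 3 + 1) ≤ 2 ^ (3 * k / 4 - 1) :=
        Nat.pow_le_pow_right two_pos (by omega)
      have h₂ : 2 ^ 1 ≤ 2 ^ (2 * k / 3) := Nat.pow_le_pow_right two_pos (by omega)
      rw [pow_succ] at h₁
      omega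
    · obtain ⟨H, h₁, h₂, h₃, -⟩ := Binomial.exists_subgraph (k := k) (by omega)
        (Nat.add_le_add_left (Nat.one_le_two_pow (n := 3 * k / 4 - 1)) _) le_rfl
      exact ⟨H, h₁, h₂, h₃⟩
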